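/- Let $T>0$, let $(\Omega,\mathcal F,P)$ be a probability space and let $\mathbb F=(\mathcal F_t)_{t\in[0,T]}$ be a filtration such that $\mathcal F_0$ is trivial (every event in $\mathcal F_0$ has probability $0$ or $1$). For a real-valued process $X=(X_t)_{t\in[0,T]}$, numbers $h\in(0,T)$, $\delta>0$, $c>0$ and a stopping time $\tau$ with values in $[0,T-h)$, put $L_t=X_{\tau+t}-X_\tau$ and $$F^0_X(\tau,h,\delta,c)=\Big\{\sup_{t\in[0,T-\tau)}|L_t|<\delta\Big\},$$ $$F^1_X(\tau,h,\delta,c)=\Big\{\sup_{t\in[0,h]}L_t<\delta\Big\}\cap\Big\{\sup_{t\in[h,T-\tau)}L_t<-c\Big\},$$ $$F^{-1}_X(\tau,h,\delta,c)=\Big\{\inf_{t\in[0,h]}L_t>-\delta\Big\}\cap\Big\{\inf_{t\in[h,T-\tau)}L_t>c\Big\}.$$ We say that $X$ satisfies condition (A) with respect to $\mathbb F$ if $X$ has continuous paths, is $\mathbb F$-adapted, and for every $h\in(0,T)$, every $\mathbb F$-stopping time $\tau$ with values in $[0,T-h)$, all $\delta>0$, $c>0$ and every $j\in\{-1,0,1\}$,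 $$P\big(F^j_X(\tau,h,\delta,c)\,\big|\,\mathcal F_\tau\big)>0\quad\text{a.s.}$$ For $\epsilon>0$, a strictly positive process $Y=(Y_t)_{t\in[0,T]}$ adapted to a filtration $\mathbb G$ admits an $\epsilon$-consistent price system ($\epsilon$-CPS) with respect to $\mathbb G$ if there are a probability measure $\tilde P$ equivalent to $P$ and a $(\mathbb G,\tilde P)$-martingale $\tilde Y$ such that, almost surely, $(1+\epsilon)^{-1}Y_t\le\tilde Y_t\le(1+\epsilon)Y_t$ for all $t\in[0,T]$. Let $X$ satisfy (A) with respect to $\mathbb F$, and let $f:\mathbb R\to\mathbb R$ be continuous and either non-decreasing with $\lim_{x\to-\infty}f(x)=-\infty$ and $\lim_{x\to+\infty}f(x)=+\infty$, or non-increasing with $\lim_{x\to-\infty}f(x)=+\infty$ and $\lim_{x\to+\infty}f(x)=-\infty$. Then $f(X)=(f(X_t))_{t\in[0,T]}$ satisfies (A) with respect to $\mathbb F$. Moreover, for every $\epsilon>0$ the process $Y_t=e^{f(X_t)}$ admits an $\epsilon$-CPS with respect to $\mathbb F$, and it also admits an $\epsilon$-CPS with respect to the natural filtration $\big(\sigma(f(X_s):s\le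 t)\big)_{t\in[0,T]}$ of $f(X)$. -/

import Mathlib

open MeasureTheory ProbabilityTheory Filter

section

variable {Ω : Type*} {T : ℝ}

/-- The event `sup_{t ∈ [0, T - τ)} |X_{τ+t} - X_τ| < δ`.
Here and below the time `s` stands for `τ + t`, so that `t ∈ [0, T - τ)` reads `τ ≤ s < T`;
suprema and infima are taken in the extended reals. -/
def stayEvent (X : Set.Icc (0 : ℝ) T → Ω → ℝ) (τ : Ω → Set.Icc (0 : ℝ) T) (δ : ℝ) : Set Ω :=
  {ω | (⨆ s : Set.Icc (0 : ℝ) T, ⨆ _ : (τ ω : ℝ) ≤ s ∧ (s : ℝ) < T,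
      ((|X s ω - X (τ ω) ω| : ℝ) : EReal)) < (δ : EReal)}

/-- The event `sup_{t ∈ [0, h]} (X_{τ+t} - X_τ) < δ` and
`sup_{t ∈ [h, T - τ)} (X_{τ+t} - X_τ) < -c`. -/
def downEvent (X : Set.Icc (0 : ℝ) T → Ω → ℝ) (τ : Ω → Set.Icc (0 : ℝ) T) (h δ c : ℝ) : Set Ω :=
  {ω | (⨆ s : Set.Icc (0 : ℝ) T, ⨆ _ : (τ ω : ℝ) ≤ s ∧ (s : ℝ) ≤ τ ω + h,
      ((X s ω - X (τ ω) ω : ℝ) : EReal)) < (δ : EReal)} ∩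
  {ω | (⨆ s : Set.Icc (0 : ℝ) T, ⨆ _ : (τ ω : ℝ) + h ≤ s ∧ (s : ℝ) < T,
      ((X s ω - X (τ ω) ω : ℝ) : EReal)) < ((-c : ℝ) : EReal)}

/-- The event `inf_{t ∈ [0, h]} (X_{τ+t} - X_τ) > -δ` and
`inf_{t ∈ [h, T - τ)} (X_{τ+t} - X_τ) > c`. -/
def upEvent (X : Set.Icc (0 : ℝ) T → Ω → ℝ) (τ : Ω → Set.Icc (0 : ℝ) T) (h δ c : ℝ) : Set Ω :=
  {ω | ((-δ : ℝ) : EReal) < ⨅ s : Set.Icc (0 : ℝ) T, ⨅ _ : (τ ω : ℝ) ≤ s ∧ (s : ℝ) ≤ τ ω + h,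
      ((X s ω - X (τ ω) ω : ℝ) : EReal)} ∩
  {ω | (c : EReal) < ⨅ s : Set.Icc (0 : ℝ) T, ⨅ _ : (τ ω : ℝ) + h ≤ s ∧ (s : ℝ) < T,
      ((X s ω - X (τ ω) ω : ℝ) : EReal)}

/-- Condition (A) for a process `X` on `[0, T]`, with respect to the filtration `𝓕` and the
measure `P`: continuous paths, adaptedness, and for all `h ∈ (0, T)`, all stopping times `τ` with
values in `[0, T - h)` and all `δ, c > 0`, each of the three events above has almost surely
positive conditional probability given `𝓕_τ`. -/
structure ConditionA {m : MeasurableSpace Ω} (P : Measure Ω)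
    (𝓕 : Filtration (Set.Icc (0 : ℝ) T) m) (X : Set.Icc (0 : ℝ) T → Ω → ℝ) : Prop where
  continuous : ∀ ω, Continuous fun t => X t ω
  adapted : StronglyAdapted 𝓕 X
  condProb_pos : ∀ h : ℝ, 0 < h → h < T → ∀ τ : Ω → Set.Icc (0 : ℝ) T,
    ∀ hτ : IsStoppingTime 𝓕 (fun ω => (τ ω : WithTop (Set.Icc (0 : ℝ) T))),
    (∀ ω, (τ ω : ℝ) < T - h) → ∀ δ : ℝ, 0 < δ → ∀ c : ℝ, 0 < c →
      (∀ᵐ ω ∂P, 0 < (P⟦stayEvent X τ δ | hτ.measurableSpace⟧) ω) ∧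
      (∀ᵐ ω ∂P, 0 < (P⟦downEvent X τ h δ c | hτ.measurableSpace⟧) ω) ∧
      (∀ᵐ ω ∂P, 0 < (P⟦upEvent X τ h δ c | hτ.measurableSpace⟧) ω)

/-- The strictly positive adapted process `Y` admits an `ε`-consistent price system with respect
to `𝓕`: there are a probability measure `Q` equivalent to `P` and an `(𝓕, Q)`-martingale `Z`
with `(1 + ε)⁻¹ Y_t ≤ Z_t ≤ (1 + ε) Y_t` for all `t ∈ [0, T]`, almost surely. -/
def AdmitsCPS {m : MeasurableSpace Ω} (P : Measure Ω)
    (𝓕 : Filtration (Set.Icc (0 : ℝ) T) m) (Y : Set.Icc (0 : ℝ) T → Ω → ℝ) (ε : ℝ) : Prop :=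
  StronglyAdapted 𝓕 Y ∧ (∀ t ω, 0 < Y t ω) ∧
  ∃ Q : Measure Ω, IsProbabilityMeasure Q ∧ Q ≪ P ∧ P ≪ Q ∧
    ∃ Z : Set.Icc (0 : ℝ) T → Ω → ℝ, Martingale Z 𝓕 Q ∧
      ∀ᵐ ω ∂P, ∀ t, (1 + ε)⁻¹ * Y t ω ≤ Z t ω ∧ Z t ω ≤ (1 + ε) * Y t ω

end

/-! Almost sure positivity of `P(A | 𝓕_τ)` means that no non-null `B ∈ 𝓕_τ` is almost disjoint from
`A` (`CondPos`). In this form it localizes over countably many pieces of `𝓕_τ` and passes to smaller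
σ-algebras. On `{|X_τ| ≤ n}`, uniform continuity and the limits of `f` turn an event for `X`, with
constants depending on `n`, into the required event for `f(X)`; this gives condition (A) for `f(X)`.

For the price system let `τ_0 = 0` and let `τ_{n+1}` be the first time after `τ_n` at which the path
has moved by `δ`, or `T`. By continuity `T` is reached after finitely many steps. Condition (A)
makes each of the outcomes up, down and no exit conditionally possible while `τ_n < T`
(`ConditionA.measure_eq_zero_of_exitEvent`), so their conditional probabilities may be prescribed.
With `κ = exp δ` and `q + qκ = 1/2`, the density `D` uses `(q, qκ, 1/2)` and `N` uses `(qκ, q,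
1/2)`. The partial products of `N` and `D` then have ratio exactly `exp (X_{τ_n} - X_0)` while `τ_n
< T`. The weight `1/2` on no exit halves the surviving mass at every step, so no mass is lost in the
limit (`exists_limit_density`).

Under `Q = D • P`, the terminal value `M = exp(X_0) N / D` therefore has conditional expectation
`exp X_{τ_n}` at `τ_n < T`. Between exit times an error of one factor `κ` comes from the path and
one from the unfinished step, hence `κ² = 1 + ε` in all (`ConditionA.exists_density_pair`,
`ConditionA.admitsCPS_exp`). -/

/-! ### Pathwise descriptions of the three events -/

lemma iSup_Icc_coe_lt_iff {α : Type*} [LinearOrder α] [TopologicalSpace α] {K : Set α}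
    (hK : IsCompact K) {g : α → ℝ} (hg : Continuous g) (c : ℝ) :
    (⨆ s, ⨆ _ : s ∈ K, ((g s : ℝ) : EReal)) < (c : EReal) ↔ ∀ s ∈ K, g s < c := by
  constructor
  · intro h s hs
    exact EReal.coe_lt_coe_iff.1 ((le_iSup₂ (f := fun s (_ : s ∈ K) => ((g s : ℝ) : EReal)) s hs).trans_lt h)
  · intro h
    rcases K.eq_empty_or_nonempty with rfl | hne
    · simp
    · obtain ⟨x, hx, hmax⟩ := hK.exists_isMaxOn hne hg.continuousOn
      refine lt_of_le_of_lt (iSup₂_le fun s hs => ?_) (EReal.coe_lt_coe_iff.2 (h x hx))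
      exact EReal.coe_le_coe_iff.2 (hmax hs)

section Paths

variable {T : ℝ}

/-- A strict bound on the supremum over `[a, T)` leaves room for a real `d` in between, and the
bound by `d` is closed, so it extends to the endpoint `T`. Conversely, the maximum over `[a, T]` is
attained. -/
lemma iSup_Ico_coe_lt_iff (hT : 0 ≤ T) {a : ℝ} (ha0 : 0 ≤ a) (haT : a < T)
    {g : Set.Icc (0 : ℝ) T → ℝ} (hg : Continuous g) (c : ℝ) :
    (⨆ s : Set.Icc (0 : ℝ) T, ⨆ _ : a ≤ s ∧ (s : ℝ) < T, ((g s : ℝ) : EReal)) < (c : EReal) ↔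
      ∀ s : Set.Icc (0 : ℝ) T, a ≤ s → g s < c := by
  let a' : Set.Icc (0 : ℝ) T := ⟨a, ha0, haT.le⟩
  let t' : Set.Icc (0 : ℝ) T := ⟨T, hT, le_rfl⟩
  have hat : a' ≠ t' := fun h => haT.ne (congrArg Subtype.val h)
  constructor
  · intro h s hs
    obtain ⟨d, hd1, hd2⟩ := EReal.lt_iff_exists_real_btwn.1 h
    have hsub : Set.Ico a' t' ⊆ {s | g s ≤ d} := by
      intro r hr
      have : ((g r : ℝ) : EReal) ≤ d :=
        (le_iSup₂ (f := fun (s : Set.Icc (0 : ℝ) T) (_ : a ≤ s ∧ (s : ℝ) < T) =>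
          ((g s : ℝ) : EReal)) r ⟨hr.1, hr.2⟩).trans hd1.le
      exact EReal.coe_le_coe_iff.1 this
    have hcl := closure_minimal hsub (isClosed_le hg continuous_const)
    rw [closure_Ico hat] at hcl
    exact lt_of_le_of_lt (hcl ⟨hs, s.2.2⟩) (EReal.coe_lt_coe_iff.1 hd2)
  · intro h
    refine lt_of_le_of_lt ?_
      ((iSup_Icc_coe_lt_iff (K := Set.Icc a' t') isClosed_Icc.isCompact hg c).2 fun s hs => h s hs.1)
    exact iSup₂_le fun s hs => le_iSup₂ (f := fun (s : Set.Icc (0 : ℝ) T)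
      (_ : s ∈ Set.Icc a' t') => ((g s : ℝ) : EReal)) s ⟨hs.1, hs.2.le⟩

variable {Ω : Type*} {X : Set.Icc (0 : ℝ) T → Ω → ℝ} {τ : Ω → Set.Icc (0 : ℝ) T}

lemma upEvent_eq_downEvent_neg (h δ c : ℝ) :
    upEvent X τ h δ c = downEvent (fun t ω => -X t ω) τ h δ c := by
  have key : ∀ (p : Set.Icc (0 : ℝ) T → Prop) (g : Set.Icc (0 : ℝ) T → ℝ) (d : ℝ),
      ((-d : ℝ) : EReal) < (⨅ s, ⨅ _ : p s, ((g s : ℝ) : EReal)) ↔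
      (⨆ s, ⨆ _ : p s, ((-g s : ℝ) : EReal)) < (d : EReal) := by
    intro p g d
    have : (⨆ s, ⨆ _ : p s, ((-g s : ℝ) : EReal)) = -(⨅ s, ⨅ _ : p s, ((g s : ℝ) : EReal)) := by
      have e1 : ∀ u : Set.Icc (0 : ℝ) T → EReal, (⨆ s, -u s) = -⨅ s, u s := fun u =>
        (EReal.negOrderIso.map_iInf u).symm
      have e2 : ∀ (r : Prop) (u : EReal), (⨆ _ : r, -u) = -⨅ _ : r, u := fun r u =>
        (EReal.negOrderIso.map_iInf fun _ : r => u).symm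
      rw [← e1]
      simp only [← e2, EReal.coe_neg]
    rw [this, EReal.neg_lt_comm, ← EReal.coe_neg]
  ext ω
  simp only [upEvent, downEvent, Set.mem_inter_iff, Set.mem_ofPred_eq]
  have e : ∀ s : Set.Icc (0 : ℝ) T, -X s ω - -X (τ ω) ω = -(X s ω - X (τ ω) ω) :=
    fun s => by ring
  simp only [e]
  rw [← key, ← key, neg_neg]

lemma mem_stayEvent_iff (hX : ∀ ω, Continuous fun t => X t ω) (hT : 0 ≤ T) {ω : Ω}
    (hτ : (τ ω : ℝ) < T) (δ : ℝ) :
    ω ∈ stayEvent X τ δ ↔ ∀ s, τ ω ≤ s → |X s ω - X (τ ω) ω| < δ :=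
  iSup_Ico_coe_lt_iff hT (τ ω).2.1 hτ ((hX ω).sub continuous_const).abs δ

lemma mem_downEvent_iff (hX : ∀ ω, Continuous fun t => X t ω) (hT : 0 ≤ T) {h : ℝ} (hh : 0 < h)
    {ω : Ω} (hτ : (τ ω : ℝ) < T - h) (δ c : ℝ) :
    ω ∈ downEvent X τ h δ c ↔
      (∀ s, τ ω ≤ s → (s : ℝ) ≤ τ ω + h → X s ω - X (τ ω) ω < δ) ∧
      ∀ s : Set.Icc (0 : ℝ) T, (τ ω : ℝ) + h ≤ s → X s ω - X (τ ω) ω < -c := by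
  have hc : Continuous fun s => X s ω - X (τ ω) ω := (hX ω).sub continuous_const
  have h0 := (τ ω).2.1
  have h1 := iSup_Ico_coe_lt_iff hT (a := (τ ω : ℝ) + h) (by linarith) (by linarith) hc (-c)
  have h2 := iSup_Icc_coe_lt_iff
    (K := Set.Icc (τ ω) ⟨(τ ω : ℝ) + h, by linarith, by linarith⟩) isClosed_Icc.isCompact hc δ
  refine and_congr (h2.trans ?_) h1
  exact ⟨fun H s a b => H s ⟨a, b⟩, fun H s hs => H s hs.1 hs.2⟩

end Paths

/-! ### Measurability of path events and of processes at stopping times -/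

section Measurability

variable {T : ℝ} {Ω : Type*}

lemma measurable_eval_of_continuous {m' : MeasurableSpace Ω} {G : Set.Icc (0 : ℝ) T → Ω → ℝ}
    (hG : ∀ ω, Continuous fun t => G t ω) (hGm : ∀ t, Measurable (G t))
    {ρ : Ω → Set.Icc (0 : ℝ) T} (hρ : Measurable ρ) : Measurable fun ω => G (ρ ω) ω :=
  (measurable_uncurry_of_continuous_of_measurable hG hGm).comp (hρ.prodMk measurable_id)

/-- By compactness the strict bound has a margin `1/(k+1)`, and by continuity it need only be tested
on a countable dense set of times. Clamping these times to `[a ω, b ω]` copes with random endpoints.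
-/
lemma measurableSet_forall_Icc_lt {m' : MeasurableSpace Ω} {G : Set.Icc (0 : ℝ) T → Ω → ℝ}
    (hG : ∀ ω, Continuous fun t => G t ω) (hGm : ∀ t, Measurable (G t))
    {a b : Ω → Set.Icc (0 : ℝ) T} (ha : Measurable a) (hb : Measurable b)
    (hab : ∀ ω, a ω ≤ b ω) (c : ℝ) :
    MeasurableSet {ω | ∀ s, a ω ≤ s → s ≤ b ω → G s ω < c} := by
  obtain ⟨D, hDc, hDd⟩ := TopologicalSpace.exists_countable_dense (Set.Icc (0 : ℝ) T)
  have : {ω | ∀ s, a ω ≤ s → s ≤ b ω → G s ω < c} =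
      ⋃ k : ℕ, ⋂ s ∈ D, {ω | G (max (a ω) (min (b ω) s)) ω ≤ c - 1 / ((k : ℝ) + 1)} := by
    ext ω
    simp only [Set.mem_ofPred_eq, Set.mem_iUnion, Set.mem_iInter]
    constructor
    · intro h
      obtain ⟨x, hx, hmax⟩ := (isClosed_Icc (a := a ω) (b := b ω)).isCompact.exists_isMaxOn
        (Set.nonempty_Icc.2 (hab ω)) (hG ω).continuousOn
      obtain ⟨k, hk⟩ := exists_nat_one_div_lt (sub_pos.2 (h x hx.1 hx.2))
      refine ⟨k, fun s _ => ?_⟩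
      have := hmax (show max (a ω) (min (b ω) s) ∈ Set.Icc (a ω) (b ω) from
        ⟨le_max_left _ _, max_le (hab ω) (min_le_left _ _)⟩)
      simp only [Set.mem_ofPred_eq] at this
      linarith
    · rintro ⟨k, hk⟩ s hs1 hs2
      have hcl : IsClosed {s | G (max (a ω) (min (b ω) s)) ω ≤ c - 1 / ((k : ℝ) + 1)} :=
        isClosed_le ((hG ω).comp (by fun_prop)) continuous_const
      have : s ∈ {s | G (max (a ω) (min (b ω) s)) ω ≤ c - 1 / ((k : ℝ) + 1)} :=
        hcl.closure_subset_iff.2 hk (hDd s)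
      simp only [Set.mem_ofPred_eq, min_eq_right hs2, max_eq_right hs1] at this
      have : 0 < 1 / ((k : ℝ) + 1) := by positivity
      linarith
  rw [this]
  refine MeasurableSet.iUnion fun k => MeasurableSet.biInter hDc fun s _ => ?_
  exact measurableSet_le
    (measurable_eval_of_continuous hG hGm (ha.max (hb.min measurable_const))) measurable_const

variable {m : MeasurableSpace Ω} {𝓕 : Filtration (Set.Icc (0 : ℝ) T) m}
  {X : Set.Icc (0 : ℝ) T → Ω → ℝ} {τ : Ω → Set.Icc (0 : ℝ) T}

lemma isStoppingTime_coe_iff :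
    IsStoppingTime 𝓕 (fun ω => (τ ω : WithTop (Set.Icc (0 : ℝ) T))) ↔
      ∀ t, MeasurableSet[𝓕 t] {ω | τ ω ≤ t} := by
  simp [IsStoppingTime]

lemma measurableSet_stopping_iff (hT : 0 ≤ T)
    (hτ : IsStoppingTime 𝓕 (fun ω => (τ ω : WithTop (Set.Icc (0 : ℝ) T)))) {B : Set Ω} :
    MeasurableSet[hτ.measurableSpace] B ↔ ∀ t, MeasurableSet[𝓕 t] (B ∩ {ω | τ ω ≤ t}) := by
  rw [hτ.measurableSet]
  simp only [WithTop.coe_le_coe]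
  refine ⟨fun h => h.2, fun h => ⟨?_, h⟩⟩
  have h1 := h ⟨T, hT, le_rfl⟩
  have h2 : B ∩ {ω | τ ω ≤ (⟨T, hT, le_rfl⟩ : Set.Icc (0 : ℝ) T)} = B :=
    Set.inter_eq_left.2 fun ω _ => (τ ω).2.2
  rw [h2] at h1
  exact le_iSup (fun t => 𝓕 t) _ _ h1

lemma measurable_min_const_of_isStoppingTime
    (hτ : IsStoppingTime 𝓕 (fun ω => (τ ω : WithTop (Set.Icc (0 : ℝ) T))))
    (t : Set.Icc (0 : ℝ) T) : Measurable[𝓕 t] fun ω => min (τ ω) t := by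
  rw [isStoppingTime_coe_iff] at hτ
  refine @measurable_of_Iic _ _ _ _ _ (𝓕 t) _ _ _ _ fun s => ?_
  rcases le_or_gt t s with h | h
  · convert @MeasurableSet.univ _ (𝓕 t)
    ext ω; simp [h]
  · convert 𝓕.mono h.le _ (hτ s) using 1
    ext ω; simp [h.not_ge]

lemma measurable_of_isStoppingTime (hT : 0 ≤ T)
    (hτ : IsStoppingTime 𝓕 (fun ω => (τ ω : WithTop (Set.Icc (0 : ℝ) T)))) : Measurable τ := by
  have h := (measurable_min_const_of_isStoppingTime hτ ⟨T, hT, le_rfl⟩).mono (𝓕.le _) le_rfl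
  have e : (fun ω => min (τ ω) (⟨T, hT, le_rfl⟩ : Set.Icc (0 : ℝ) T)) = τ :=
    funext fun ω => min_eq_left (τ ω).2.2
  rwa [e] at h

/-- The process frozen at `t` is continuous and entirely `𝓕 t`-measurable, so it may be evaluated at
the `𝓕 t`-measurable time `min τ t`. -/
lemma measurable_process_min (hX : ∀ ω, Continuous fun t => X t ω) (hXa : StronglyAdapted 𝓕 X)
    (hτ : IsStoppingTime 𝓕 (fun ω => (τ ω : WithTop (Set.Icc (0 : ℝ) T))))
    (t : Set.Icc (0 : ℝ) T) : Measurable[𝓕 t] fun ω => X (min (τ ω) t) ω := by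
  have h := @measurable_eval_of_continuous T Ω (𝓕 t) (fun s ω => X (min s t) ω)
    (fun ω => (hX ω).comp (by fun_prop))
    (fun s => ((hXa (min s t)).mono (𝓕.mono (min_le_right _ _))).measurable)
    _ (measurable_min_const_of_isStoppingTime hτ t)
  simpa using h

lemma measurable_process_at_stopping (hT : 0 ≤ T) (hX : ∀ ω, Continuous fun t => X t ω)
    (hXa : StronglyAdapted 𝓕 X)
    (hτ : IsStoppingTime 𝓕 (fun ω => (τ ω : WithTop (Set.Icc (0 : ℝ) T)))) :
    Measurable[hτ.measurableSpace] fun ω => X (τ ω) ω := by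
  refine @measurable_of_Iic _ _ _ _ _ hτ.measurableSpace _ _ _ _ fun c => ?_
  rw [measurableSet_stopping_iff hT]
  intro t
  have h1 := measurable_process_min hX hXa hτ t
  have : ((fun ω => X (τ ω) ω) ⁻¹' Set.Iic c) ∩ {ω | τ ω ≤ t} =
      ((fun ω => X (min (τ ω) t) ω) ⁻¹' Set.Iic c) ∩ {ω | τ ω ≤ t} := by
    ext ω
    simp only [Set.mem_inter_iff, Set.mem_preimage, Set.mem_Iic, Set.mem_ofPred_eq]
    refine and_congr_left fun h => ?_
    rw [min_eq_left h]
  rw [this]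
  exact (h1 measurableSet_Iic).inter (isStoppingTime_coe_iff.1 hτ t)

lemma measurableSet_of_subset_ge (hT : 0 ≤ T)
    (hτ : IsStoppingTime 𝓕 (fun ω => (τ ω : WithTop (Set.Icc (0 : ℝ) T))))
    {t : Set.Icc (0 : ℝ) T} {B : Set Ω} (hB : MeasurableSet[𝓕 t] B) (hBt : ∀ ω ∈ B, t ≤ τ ω) :
    MeasurableSet[hτ.measurableSpace] B := by
  rw [measurableSet_stopping_iff hT]
  intro s
  rcases lt_or_ge s t with h | h
  · convert @MeasurableSet.empty _ (𝓕 s)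
    ext ω
    simp only [Set.mem_inter_iff, Set.mem_ofPred_eq, Set.mem_empty_iff_false, iff_false, not_and,
      not_le]
    exact fun hω => h.trans_le (hBt ω hω)
  · exact (𝓕.mono h _ hB).inter (isStoppingTime_coe_iff.1 hτ s)

lemma measurableSet_stayEvent (hT : 0 ≤ T) (hX : ∀ ω, Continuous fun t => X t ω)
    (hXm : ∀ t, Measurable (X t)) (hτ : Measurable τ) (hτT : ∀ ω, (τ ω : ℝ) < T) (δ : ℝ) :
    MeasurableSet (stayEvent X τ δ) := by
  have hXτ := measurable_eval_of_continuous hX hXm hτ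
  have h := measurableSet_forall_Icc_lt (G := fun s ω => |X s ω - X (τ ω) ω|)
    (fun ω => ((hX ω).sub continuous_const).abs)
    (fun t => continuous_abs.measurable.comp ((hXm t).sub hXτ)) hτ
    (measurable_const (a := (⟨T, hT, le_rfl⟩ : Set.Icc (0 : ℝ) T))) (fun ω => (τ ω).2.2) δ
  convert h using 1
  ext ω
  rw [mem_stayEvent_iff hX hT (hτT ω)]
  exact ⟨fun H s h1 _ => H s h1, fun H s h1 => H s h1 s.2.2⟩

lemma measurableSet_downEvent (hT : 0 ≤ T) (hX : ∀ ω, Continuous fun t => X t ω)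
    (hXm : ∀ t, Measurable (X t)) (hτ : Measurable τ) {h : ℝ} (hh : 0 < h)
    (hτT : ∀ ω, (τ ω : ℝ) < T - h) (δ c : ℝ) : MeasurableSet (downEvent X τ h δ c) := by
  have hXτ := measurable_eval_of_continuous hX hXm hτ
  let σ : Ω → Set.Icc (0 : ℝ) T := fun ω =>
    ⟨(τ ω : ℝ) + h, by linarith [(τ ω).2.1], by linarith [hτT ω]⟩
  have hσ : Measurable σ := ((measurable_subtype_coe.comp hτ).add_const h).subtype_mk
  have hτσ : ∀ ω, τ ω ≤ σ ω := fun ω => Subtype.coe_le_coe.1 (by simp [σ, hh.le])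
  have hc : ∀ ω, Continuous fun s => X s ω - X (τ ω) ω := fun ω => (hX ω).sub continuous_const
  have h1 := measurableSet_forall_Icc_lt (G := fun s ω => X s ω - X (τ ω) ω) hc
    (fun t => (hXm t).sub hXτ) hτ hσ hτσ δ
  have h2 := measurableSet_forall_Icc_lt (G := fun s ω => X s ω - X (τ ω) ω) hc
    (fun t => (hXm t).sub hXτ) hσ
    (measurable_const (a := (⟨T, hT, le_rfl⟩ : Set.Icc (0 : ℝ) T))) (fun ω => (σ ω).2.2) (-c)
  convert h1.inter h2 using 1
  ext ω
  rw [mem_downEvent_iff hX hT hh (hτT ω)]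
  exact and_congr Iff.rfl ⟨fun H s h1 _ => H s h1, fun H s h1 => H s h1 s.2.2⟩

end Measurability
-- Positive conditional probability without conditional expectations
section CondPos

variable {Ω : Type*}

/-- The event `A` has almost surely positive conditional probability given `m'`, expressed
without conditional expectations. -/
def CondPos {m : MeasurableSpace Ω} (P : Measure Ω) (m' : MeasurableSpace Ω) (A : Set Ω) : Prop :=
  ∀ B, MeasurableSet[m'] B → P (B ∩ A) = 0 → P B = 0

/-- The conditional probability integrates to `P (B ∩ A)` over `B`. For the converse, the test set
is the one on which it is nonpositive. -/
lemma condProb_pos_iff_condPos {m' m : MeasurableSpace Ω} {P : Measure Ω} [IsProbabilityMeasure P]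
    (hm : m' ≤ m) {A : Set Ω} (hA : MeasurableSet A) :
    (∀ᵐ ω ∂P, 0 < (P⟦A | m'⟧) ω) ↔ CondPos P m' A := by
  have hint : Integrable (A.indicator fun _ => (1 : ℝ)) P := (integrable_const 1).indicator hA
  have key : ∀ B, MeasurableSet[m'] B → ∫ ω in B, (P⟦A | m'⟧) ω ∂P = P.real (B ∩ A) := by
    intro B hB
    rw [setIntegral_condExp hm hint hB, setIntegral_indicator hA]
    simp
  constructor
  · intro h B hB h0
    have h1 := key B hB
    rw [measureReal_def, h0, ENNReal.toReal_zero,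
      setIntegral_eq_zero_iff_of_nonneg_ae (ae_restrict_of_ae (h.mono fun _ h => h.le))
        integrable_condExp.integrableOn] at h1
    have h2 : ∀ᵐ ω ∂(P.restrict B), False := by
      filter_upwards [h1, ae_restrict_of_ae h] with ω h3 h4
      exact h4.ne' h3
    simpa using h2
  · intro h
    let B : Set Ω := {ω | (P⟦A | m'⟧) ω ≤ 0}
    have hB : MeasurableSet[m'] B :=
      
      (stronglyMeasurable_condExp (m := m') (μ := P) (f := A.indicator fun _ => (1 : ℝ))).measurable
        measurableSet_Iic
    have h1 : ∫ ω in B, (P⟦A | m'⟧) ω ∂P ≤ 0 := setIntegral_nonpos (hm _ hB) fun ω hω => hω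
    rw [key B hB] at h1
    have h2 : P (B ∩ A) = 0 :=
      (measureReal_eq_zero_iff).1 (le_antisymm h1 measureReal_nonneg)
    have h3 := h B hB h2
    rw [ae_iff]
    simpa [B] using h3

lemma CondPos.of_le {m₁ m₂ _m : MeasurableSpace Ω} {P : Measure Ω} {A : Set Ω} (h : CondPos P m₂ A)
    (hle : m₁ ≤ m₂) : CondPos P m₁ A :=
  fun B hB => h B (hle B hB)

lemma CondPos.of_localize {m' m : MeasurableSpace Ω} {P : Measure Ω} {A : Set Ω} {K : ℕ → Set Ω}
    (hK : ∀ n, MeasurableSet[m'] (K n)) (hU : ⋃ n, K n = Set.univ) {A' : ℕ → Set Ω}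
    (hA' : ∀ n, CondPos P m' (A' n)) (hsub : ∀ n, K n ∩ A' n ⊆ A) : CondPos P m' A := by
  intro B hB h0
  have h1 : ∀ n, P (B ∩ K n) = 0 := fun n =>
    hA' n _ (hB.inter (hK n)) (measure_mono_null (t := B ∩ A)
      (fun ω hω => ⟨hω.1.1, hsub n ⟨hω.1.2, hω.2⟩⟩) h0)
  have h2 : B = ⋃ n, B ∩ K n := by rw [← Set.inter_iUnion, hU, Set.inter_univ]
  rw [h2]
  exact measure_iUnion_null h1

end CondPos

/-! ### Stability of condition (A) under negation, monotone maps and smaller filtrations -/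

section ConditionA

variable {Ω : Type*} {m : MeasurableSpace Ω} {P : Measure Ω} [IsProbabilityMeasure P] {T : ℝ}
  {𝓕 : Filtration (Set.Icc (0 : ℝ) T) m} {X : Set.Icc (0 : ℝ) T → Ω → ℝ}

lemma MeasureTheory.StronglyAdapted.measurable_of_filtration (hX : StronglyAdapted 𝓕 X)
    (t : Set.Icc (0 : ℝ) T) : Measurable (X t) :=
  ((hX t).mono (𝓕.le t)).measurable

lemma measurableSet_upEvent {τ : Ω → Set.Icc (0 : ℝ) T} (hT : 0 ≤ T)
    (hX : ∀ ω, Continuous fun t => X t ω)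
    (hXm : ∀ t, Measurable (X t)) (hτ : Measurable τ) {h : ℝ} (hh : 0 < h)
    (hτT : ∀ ω, (τ ω : ℝ) < T - h) (δ c : ℝ) : MeasurableSet (upEvent X τ h δ c) := by
  rw [upEvent_eq_downEvent_neg]
  exact measurableSet_downEvent hT (fun ω => (hX ω).neg) (fun t => (hXm t).neg) hτ hh hτT δ c

lemma conditionA_iff (hT : 0 ≤ T) : ConditionA P 𝓕 X ↔
    (∀ ω, Continuous fun t => X t ω) ∧ StronglyAdapted 𝓕 X ∧
    ∀ h : ℝ, 0 < h → h < T → ∀ τ : Ω → Set.Icc (0 : ℝ) T,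
      ∀ hτ : IsStoppingTime 𝓕 (fun ω => (τ ω : WithTop (Set.Icc (0 : ℝ) T))),
      (∀ ω, (τ ω : ℝ) < T - h) → ∀ δ : ℝ, 0 < δ → ∀ c : ℝ, 0 < c →
        CondPos P hτ.measurableSpace (stayEvent X τ δ) ∧
        CondPos P hτ.measurableSpace (downEvent X τ h δ c) ∧
        CondPos P hτ.measurableSpace (upEvent X τ h δ c) := by
  have key : (∀ ω, Continuous fun t => X t ω) → StronglyAdapted 𝓕 X → ∀ h : ℝ, 0 < h →
      ∀ τ : Ω → Set.Icc (0 : ℝ) T,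
      ∀ hτ : IsStoppingTime 𝓕 (fun ω => (τ ω : WithTop (Set.Icc (0 : ℝ) T))),
      (∀ ω, (τ ω : ℝ) < T - h) → ∀ δ c : ℝ,
      (((∀ᵐ ω ∂P, 0 < (P⟦stayEvent X τ δ | hτ.measurableSpace⟧) ω) ∧
        (∀ᵐ ω ∂P, 0 < (P⟦downEvent X τ h δ c | hτ.measurableSpace⟧) ω) ∧
        (∀ᵐ ω ∂P, 0 < (P⟦upEvent X τ h δ c | hτ.measurableSpace⟧) ω)) ↔
      (CondPos P hτ.measurableSpace (stayEvent X τ δ) ∧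
        CondPos P hτ.measurableSpace (downEvent X τ h δ c) ∧
        CondPos P hτ.measurableSpace (upEvent X τ h δ c))) := by
    intro hc ha h hh τ hτ hτT δ c
    have hle := hτ.measurableSpace_le
    have hXm := ha.measurable_of_filtration
    have hτm := measurable_of_isStoppingTime hT hτ
    exact and_congr
      (condProb_pos_iff_condPos hle (measurableSet_stayEvent hT hc hXm hτm
        (fun ω => by linarith [hτT ω]) δ))
      (and_congr
        (condProb_pos_iff_condPos hle (measurableSet_downEvent hT hc hXm hτm hh hτT δ c))
        (condProb_pos_iff_condPos hle (measurableSet_upEvent hT hc hXm hτm hh hτT δ c)))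
  constructor
  · rintro ⟨hc, ha, H⟩
    exact ⟨hc, ha, fun h hh hhT τ hτ hτT δ hδ c hc' =>
      (key hc ha h hh τ hτ hτT δ c).1 (H h hh hhT τ hτ hτT δ hδ c hc')⟩
  · rintro ⟨hc, ha, H⟩
    exact ⟨hc, ha, fun h hh hhT τ hτ hτT δ hδ c hc' =>
      (key hc ha h hh τ hτ hτT δ c).2 (H h hh hhT τ hτ hτT δ hδ c hc')⟩

lemma stayEvent_neg (τ : Ω → Set.Icc (0 : ℝ) T) (δ : ℝ) :
    stayEvent (fun t ω => -X t ω) τ δ = stayEvent X τ δ := by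
  have e : ∀ (s : Set.Icc (0 : ℝ) T) ω, |-X s ω - -X (τ ω) ω| = |X s ω - X (τ ω) ω| :=
    fun s ω => by rw [← abs_neg]; congr 1; ring
  simp only [stayEvent, e]

lemma ConditionA.neg (hT : 0 ≤ T) (hX : ConditionA P 𝓕 X) :
    ConditionA P 𝓕 (fun t ω => -X t ω) := by
  rw [conditionA_iff hT] at hX ⊢
  refine ⟨fun ω => (hX.1 ω).neg, fun t => (hX.2.1 t).neg, ?_⟩
  intro h hh hhT τ hτ hτT δ hδ c hc
  obtain ⟨h1, h2, h3⟩ := hX.2.2 h hh hhT τ hτ hτT δ hδ c hc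
  refine ⟨by rwa [stayEvent_neg], by rwa [← upEvent_eq_downEvent_neg], ?_⟩
  rw [upEvent_eq_downEvent_neg]
  simpa only [neg_neg] using h2

lemma exists_modulus_of_continuous {f : ℝ → ℝ} (hf : Continuous f) (n : ℕ) {δ : ℝ} (hδ : 0 < δ) :
    ∃ η > 0, ∀ x y : ℝ, |x| ≤ n → |y - x| < η → |f y - f x| < δ := by
  have hu := (isCompact_Icc (a := -((n : ℝ) + 1)) (b := n + 1)).uniformContinuousOn_of_continuous
    hf.continuousOn
  obtain ⟨η, hη, H⟩ := Metric.uniformContinuousOn_iff.1 hu δ hδ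
  -- The cap `1` keeps `y` in the interval `[-(n+1), n+1]` of uniform continuity.
  refine ⟨min η 1, lt_min hη one_pos, fun x y hx hxy => ?_⟩
  have h1 := abs_le.1 hx
  have h2 := abs_lt.1 (hxy.trans_le (min_le_right _ _))
  have := H y ⟨by linarith, by linarith⟩ x ⟨by linarith, by linarith⟩
    (by rw [Real.dist_eq]; exact hxy.trans_le (min_le_left _ _))
  rwa [Real.dist_eq] at this

lemma ConditionA.condPos_stayEvent_comp (hT : 0 ≤ T) (hX : ConditionA P 𝓕 X) {f : ℝ → ℝ}
    (hf : Continuous f) {h : ℝ} (hh : 0 < h) (hhT : h < T) {τ : Ω → Set.Icc (0 : ℝ) T}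
    (hτ : IsStoppingTime 𝓕 (fun ω => (τ ω : WithTop (Set.Icc (0 : ℝ) T))))
    (hτT : ∀ ω, (τ ω : ℝ) < T - h) {δ : ℝ} (hδ : 0 < δ) :
    CondPos P hτ.measurableSpace (stayEvent (fun t ω => f (X t ω)) τ δ) := by
  obtain ⟨hc, ha, H⟩ := (conditionA_iff hT).1 hX
  choose η hη hmod using fun n => exists_modulus_of_continuous hf n hδ
  have hXτ := measurable_process_at_stopping hT hc ha hτ
  refine CondPos.of_localize (K := fun n : ℕ => {ω | |X (τ ω) ω| ≤ n})
    (fun n => (continuous_abs.measurable.comp hXτ) measurableSet_Iic)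
    (Set.eq_univ_of_forall fun ω => Set.mem_iUnion.2 (exists_nat_ge |X (τ ω) ω|))
    (fun n => (H h hh hhT τ hτ hτT (η n) (hη n) 1 one_pos).1) ?_
  rintro n ω ⟨hω1, hω2⟩
  have hω : (τ ω : ℝ) < T := by linarith [hτT ω]
  rw [mem_stayEvent_iff (X := fun t ω => f (X t ω)) (fun ω => hf.comp (hc ω)) hT hω]
  rw [mem_stayEvent_iff hc hT hω] at hω2
  exact fun s hs => hmod n _ _ hω1 (hω2 s hs)

lemma ConditionA.condPos_downEvent_comp (hT : 0 ≤ T) (hX : ConditionA P 𝓕 X) {f : ℝ → ℝ}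
    (hf : Continuous f) (hmono : Monotone f) (hbot : Tendsto f atBot atBot)
    {h : ℝ} (hh : 0 < h) (hhT : h < T) {τ : Ω → Set.Icc (0 : ℝ) T}
    (hτ : IsStoppingTime 𝓕 (fun ω => (τ ω : WithTop (Set.Icc (0 : ℝ) T))))
    (hτT : ∀ ω, (τ ω : ℝ) < T - h) {δ : ℝ} (hδ : 0 < δ) (c : ℝ) :
    CondPos P hτ.measurableSpace (downEvent (fun t ω => f (X t ω)) τ h δ c) := by
  obtain ⟨hc, ha, H⟩ := (conditionA_iff hT).1 hX
  choose η hη hmod using fun n => exists_modulus_of_continuous hf n hδ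
  -- Below `z n`, `f` is less than `f (-n) - c`, hence less than `f (X_τ) - c` when `|X_τ| ≤ n`. A
  -- fall of `X` by more than `n - z n` reaches this region; the maximum with `1` below only keeps
  -- the level positive.
  choose z hz using fun n : ℕ => (eventually_atBot.1
    (hbot.eventually (eventually_lt_atBot (f (-n) - c))))
  have hXτ := measurable_process_at_stopping hT hc ha hτ
  refine CondPos.of_localize (K := fun n : ℕ => {ω | |X (τ ω) ω| ≤ n})
    (fun n => (continuous_abs.measurable.comp hXτ) measurableSet_Iic)
    (Set.eq_univ_of_forall fun ω => Set.mem_iUnion.2 (exists_nat_ge |X (τ ω) ω|))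
    (fun n => (H h hh hhT τ hτ hτT (η n) (hη n) (max 1 (n - z n))
      (one_pos.trans_le (le_max_left _ _))).2.1) ?_
  rintro n ω ⟨hω1, hω2⟩
  rw [mem_downEvent_iff (X := fun t ω => f (X t ω)) (fun ω => hf.comp (hc ω)) hT hh (hτT ω)]
  rw [mem_downEvent_iff hc hT hh (hτT ω)] at hω2
  have hb : -(n : ℝ) ≤ X (τ ω) ω ∧ X (τ ω) ω ≤ n := abs_le.1 hω1
  refine ⟨fun s hs1 hs2 => ?_, fun s hs => ?_⟩
  · rcases le_total (X s ω) (X (τ ω) ω) with hle | hle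
    · exact (sub_nonpos.2 (hmono hle)).trans_lt hδ
    · have h1 := hω2.1 s hs1 hs2
      rw [← abs_of_nonneg (sub_nonneg.2 hle)] at h1
      exact (le_abs_self _).trans_lt (hmod n _ _ hω1 h1)
  · have h1 := hω2.2 s hs
    have h2 := le_max_right 1 ((n : ℝ) - z n)
    have h3 := hz n (X s ω) (by linarith)
    have h4 := hmono hb.1
    linarith

lemma ConditionA.comp_monotone (hT : 0 ≤ T) (hX : ConditionA P 𝓕 X) {f : ℝ → ℝ}
    (hf : Continuous f) (hmono : Monotone f) (hbot : Tendsto f atBot atBot)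
    (htop : Tendsto f atTop atTop) : ConditionA P 𝓕 (fun t ω => f (X t ω)) := by
  rw [conditionA_iff hT]
  refine ⟨fun ω => hf.comp (hX.continuous ω),
    fun t => hf.comp_stronglyMeasurable (hX.adapted t), ?_⟩
  intro h hh hhT τ hτ hτT δ hδ c hc
  refine ⟨hX.condPos_stayEvent_comp hT hf hh hhT hτ hτT hδ,
    hX.condPos_downEvent_comp hT hf hmono hbot hh hhT hτ hτT hδ c, ?_⟩
  -- An upward move of `f(X)` is a downward move of `-f(X)`, the image of `-X` under the monotone
  -- map `x ↦ -f (-x)`.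
  have := (hX.neg hT).condPos_downEvent_comp hT (f := fun x => -f (-x)) (by fun_prop)
    (fun x y hxy => neg_le_neg (hmono (neg_le_neg hxy)))
    (tendsto_neg_atTop_atBot.comp (htop.comp tendsto_neg_atBot_atTop)) hh hhT hτ hτT hδ c
  rw [upEvent_eq_downEvent_neg]
  simpa only [neg_neg] using this

/-- A smaller filtration has fewer stopping times, and fewer test sets at each of them. -/
lemma ConditionA.mono_filtration (hT : 0 ≤ T) (hX : ConditionA P 𝓕 X)
    {𝓖 : Filtration (Set.Icc (0 : ℝ) T) m} (hle : 𝓖 ≤ 𝓕) (ha : StronglyAdapted 𝓖 X) :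
    ConditionA P 𝓖 X := by
  rw [conditionA_iff hT] at hX ⊢
  refine ⟨hX.1, ha, ?_⟩
  intro h hh hhT τ hτ hτT δ hδ c hc
  have hτ' : IsStoppingTime 𝓕 (fun ω => (τ ω : WithTop (Set.Icc (0 : ℝ) T))) :=
    fun t => hle t _ (hτ t)
  have hms : hτ.measurableSpace ≤ hτ'.measurableSpace := by
    intro B hB
    rw [measurableSet_stopping_iff hT] at hB ⊢
    exact fun t => hle t _ (hB t)
  obtain ⟨h1, h2, h3⟩ := hX.2.2 h hh hhT τ hτ' hτT δ hδ c hc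
  exact ⟨h1.of_le hms, h2.of_le hms, h3.of_le hms⟩

end ConditionA
-- Prescribing conditional probabilities by a change of density
section Densities

open scoped ENNReal

variable {Ω : Type*}

/-- The weight plays the role of `1 / P(E | m')` on `R`: it is the Radon–Nikodym derivative, on
`m'`, of `P` restricted to `R` with respect to `P` restricted to `E`. The two restrictions are
equivalent on `m'` by `hpos` and `E ⊆ R`. -/
lemma exists_conditional_weight {m' m : MeasurableSpace Ω} (hm : m' ≤ m) {P : Measure Ω}
    [IsFiniteMeasure P] {R E : Set Ω} (hR : MeasurableSet[m'] R) (hE : MeasurableSet E)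
    (hER : E ⊆ R)
    (hpos : ∀ B, MeasurableSet[m'] B → B ⊆ R → P (B ∩ E) = 0 → P B = 0) :
    ∃ ρ : Ω → ℝ≥0∞, Measurable[m'] ρ ∧
      (∀ g : Ω → ℝ≥0∞, Measurable[m'] g →
        ∫⁻ ω, E.indicator ρ ω * g ω ∂P = ∫⁻ ω in R, g ω ∂P) ∧
      ∀ᵐ ω ∂P, ω ∈ E → 0 < ρ ω ∧ ρ ω < ∞ := by
  set μR := (P.restrict R).trim hm with hμR
  set μE := (P.restrict E).trim hm with hμE
  have hRE : μR ≪ μE := by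
    refine @Measure.AbsolutelyContinuous.mk _ m' _ _ fun B hB h0 => ?_
    rw [hμE, trim_measurableSet_eq hm hB, Measure.restrict_apply (hm _ hB)] at h0
    rw [hμR, trim_measurableSet_eq hm hB, Measure.restrict_apply (hm _ hB)]
    refine hpos _ (hB.inter hR) Set.inter_subset_right (measure_mono_null ?_ h0)
    exact fun ω hω => ⟨hω.1.1, hω.2⟩
  have hEmR : μE ≪ μR := by
    refine @Measure.AbsolutelyContinuous.mk _ m' _ _ fun B hB h0 => ?_
    rw [hμR, trim_measurableSet_eq hm hB, Measure.restrict_apply (hm _ hB)] at h0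
    rw [hμE, trim_measurableSet_eq hm hB, Measure.restrict_apply (hm _ hB)]
    exact measure_mono_null (Set.inter_subset_inter_right _ hER) h0
  have hρm : Measurable[m'] (μR.rnDeriv μE) := Measure.measurable_rnDeriv _ _
  refine ⟨μR.rnDeriv μE, hρm, ?_, ?_⟩
  · intro g hg
    have h1 := lintegral_rnDeriv_mul hRE (f := g) (@Measurable.aemeasurable _ _ m' _ _ _ hg)
    have h2 : ∫⁻ ω, μR.rnDeriv μE ω * g ω ∂μE = ∫⁻ ω in E, μR.rnDeriv μE ω * g ω ∂P :=
      lintegral_trim hm (hρm.mul hg)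
    have h3 : ∫⁻ ω, g ω ∂μR = ∫⁻ ω in R, g ω ∂P := lintegral_trim hm hg
    rw [h2, h3] at h1
    rw [← h1, ← lintegral_indicator hE]
    refine lintegral_congr fun ω => ?_
    by_cases hω : ω ∈ E <;> simp [hω]
  · have h1 : ∀ᵐ ω ∂μE, 0 < μR.rnDeriv μE ω ∧ μR.rnDeriv μE ω < ∞ :=
      (Measure.rnDeriv_pos' hEmR).and (Measure.rnDeriv_lt_top _ _)
    exact (ae_restrict_iff' hE).1 (ae_of_ae_trim hm h1)

/-- The density equal to `a i * ρ i` on `E i` and to `1` off `R`. -/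
noncomputable def stepDensity {ι : Type*} [Fintype ι] (R : Set Ω) (E : ι → Set Ω)
    (ρ : ι → Ω → ℝ≥0∞) (a : ι → ℝ≥0∞) (ω : Ω) : ℝ≥0∞ :=
  Rᶜ.indicator 1 ω + ∑ i, a i * (E i).indicator (ρ i) ω

variable {ι : Type*} [Fintype ι]

lemma stepDensity_of_notMem {R : Set Ω} {E : ι → Set Ω} (hER : ∀ i, E i ⊆ R)
    (ρ : ι → Ω → ℝ≥0∞) (a : ι → ℝ≥0∞) {ω : Ω} (hω : ω ∉ R) :
    stepDensity R E ρ a ω = 1 := by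
  have : ∀ i, ω ∉ E i := fun i h => hω (hER i h)
  simp [stepDensity, hω, this]

lemma stepDensity_of_mem {R : Set Ω} {E : ι → Set Ω} (hER : ∀ i, E i ⊆ R)
    (hd : Pairwise fun i j => Disjoint (E i) (E j))
    (ρ : ι → Ω → ℝ≥0∞) (a : ι → ℝ≥0∞) {ω : Ω} {i : ι} (hω : ω ∈ E i) :
    stepDensity R E ρ a ω = a i * ρ i ω := by
  have hj : ∀ j, j ≠ i → ω ∉ E j := fun j hj h => (Set.disjoint_left.1 (hd hj)) h hω
  rw [stepDensity, Finset.sum_eq_single i (fun j _ hji => by simp [hj j hji]) (by simp)]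
  simp [hER i hω, hω]

lemma measurable_stepDensity {m : MeasurableSpace Ω} {R : Set Ω} {E : ι → Set Ω}
    {ρ : ι → Ω → ℝ≥0∞} (hR : MeasurableSet R) (hE : ∀ i, MeasurableSet (E i))
    (hρ : ∀ i, Measurable (ρ i)) (a : ι → ℝ≥0∞) : Measurable (stepDensity R E ρ a) :=
  (measurable_one.indicator hR.compl).add
    (Finset.measurable_fun_sum _ fun i _ => ((hρ i).indicator (hE i)).const_mul (a i))

lemma lintegral_stepDensity_mul {m : MeasurableSpace Ω} {P : Measure Ω} {R : Set Ω}
    {E : ι → Set Ω} {ρ : ι → Ω → ℝ≥0∞} (hR : MeasurableSet R) (hE : ∀ i, MeasurableSet (E i))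
    (hρ : ∀ i, Measurable (ρ i)) (a : ι → ℝ≥0∞) {g : Ω → ℝ≥0∞} (hg : Measurable g)
    (hρg : ∀ i, ∫⁻ ω, (E i).indicator (ρ i) ω * g ω ∂P = ∫⁻ ω in R, g ω ∂P) :
    ∫⁻ ω, stepDensity R E ρ a ω * g ω ∂P =
      ∫⁻ ω in Rᶜ, g ω ∂P + (∑ i, a i) * ∫⁻ ω in R, g ω ∂P := by
  have hm : ∀ i, Measurable fun ω => a i * ((E i).indicator (ρ i) ω * g ω) := fun i =>
    (((hρ i).indicator (hE i)).mul hg).const_mul (a i)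
  simp only [stepDensity, add_mul, Finset.sum_mul, mul_assoc]
  have hm0 : Measurable fun ω => Rᶜ.indicator (1 : Ω → ℝ≥0∞) ω * g ω :=
    (measurable_one.indicator hR.compl).mul hg
  rw [lintegral_add_left hm0,
    lintegral_finsetSum _ fun i _ => hm i]
  congr 1
  · rw [← lintegral_indicator hR.compl]
    refine lintegral_congr fun ω => ?_
    by_cases hω : ω ∈ R <;> simp [hω]
  · refine Finset.sum_congr rfl fun i _ => ?_
    have hm1 : Measurable fun ω => (E i).indicator (ρ i) ω * g ω :=
      ((hρ i).indicator (hE i)).mul hg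
    rw [lintegral_const_mul _ hm1, hρg i]

/-- Successive products of densities `d n` that are conditional densities along the increasing
family of `σ`-algebras `G n`, are trivial off the alive set `R n`, and for which the alive mass
at least halves at each step, converge to a density that closes the martingale of products. -/
lemma exists_limit_density {m : MeasurableSpace Ω} {P : Measure Ω} [IsProbabilityMeasure P]
    {G : ℕ → MeasurableSpace Ω} (hGm : ∀ n, G n ≤ m) (hG : Monotone G)
    {R : ℕ → Set Ω} (hR : ∀ n, MeasurableSet[G n] (R n)) (hRanti : Antitone R)
    {d : ℕ → Ω → ℝ≥0∞} (hd : ∀ n, Measurable[G (n + 1)] (d n))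
    (hd1 : ∀ n, ∀ ω ∉ R n, d n ω = 1)
    (hmart : ∀ n (g : Ω → ℝ≥0∞), Measurable[G n] g → ∫⁻ ω, d n ω * g ω ∂P = ∫⁻ ω, g ω ∂P)
    (hsurv : ∀ n (g : Ω → ℝ≥0∞), Measurable[G n] g →
      ∫⁻ ω in R (n + 1), d n ω * g ω ∂P ≤ 2⁻¹ * ∫⁻ ω in R n, g ω ∂P) :
    ∃ W : Ω → ℝ≥0∞, Measurable W ∧
      (∀ n, ∀ ω ∉ R n, W ω = ∏ k ∈ Finset.range n, d k ω) ∧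
      ∀ n (g : Ω → ℝ≥0∞), Measurable[G n] g →
        ∫⁻ ω, W ω * g ω ∂P = ∫⁻ ω, (∏ k ∈ Finset.range n, d k ω) * g ω ∂P := by
  set w : ℕ → Ω → ℝ≥0∞ := fun n ω => ∏ k ∈ Finset.range n, d k ω with hw
  have hwm : ∀ n, Measurable[G n] (w n) := fun n =>
    @Finset.measurable_fun_prod _ _ _ _ _ _ (G n) _ _ fun k hk =>
      (hd k).mono (hG (Finset.mem_range.1 hk)) le_rfl
  have hwm' : ∀ n, Measurable (w n) := fun n => (hwm n).mono (hGm n) le_rfl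
  have hws : ∀ n ω, w (n + 1) ω = d n ω * w n ω := fun n ω => by
    simp only [hw, Finset.prod_range_succ, mul_comm]
  have hconst : ∀ n, ∀ ω ∉ R n, ∀ k, n ≤ k → w k ω = w n ω := by
    intro n ω hω k hk
    induction k, hk using Nat.le_induction with
    | base => rfl
    | succ k hk ih => rw [hws, hd1 k ω (fun h => hω (hRanti hk h)), one_mul, ih]
  -- Off `R n` the sequence is constant from index `n` on. The `liminf` supplies a measurable
  -- function everywhere and allows Fatou's lemma.
  set W : Ω → ℝ≥0∞ := fun ω => liminf (fun n => w n ω) atTop with hWdef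
  have hWm : Measurable W := Measurable.liminf hwm'
  have hW : ∀ n, ∀ ω ∉ R n, W ω = w n ω := by
    intro n ω hω
    refine Tendsto.liminf_eq (tendsto_const_nhds.congr' ?_)
    filter_upwards [eventually_ge_atTop n] with k hk
    exact (hconst n ω hω k hk).symm
  refine ⟨W, hWm, hW, ?_⟩
  have hstep : ∀ n k, n ≤ k → ∀ B, MeasurableSet[G n] B →
      ∫⁻ ω in B, w k ω ∂P = ∫⁻ ω in B, w n ω ∂P := by
    intro n k hk B hB
    induction k, hk using Nat.le_induction with
    | base => rfl
    | succ k hk ih =>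
      have hBk := hG hk _ hB
      rw [← ih, ← lintegral_indicator (hGm n _ hB), ← lintegral_indicator (hGm n _ hB),
        ← hmart k _ ((hwm k).indicator hBk)]
      refine lintegral_congr fun ω => ?_
      by_cases hω : ω ∈ B <;> simp [hω, hws]
  have halive : ∀ n, ∫⁻ ω in R n, w n ω ∂P ≤ 2⁻¹ ^ n := by
    intro n
    induction n with
    | zero =>
      have : ∀ ω, w 0 ω = 1 := fun ω => by simp [hw]
      simp only [this, setLIntegral_one, pow_zero]
      exact prob_le_one
    | succ n ih =>
      simp only [hws]
      refine (hsurv n _ (hwm n)).trans ?_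
      rw [pow_succ']
      gcongr
  -- Fatou gives `≤`. For `≥`, `W` and `w k` agree off `R k`, where `w k` carries all but a mass of
  -- at most `2⁻¹ ^ k`.
  have hset : ∀ n B, MeasurableSet[G n] B → ∫⁻ ω in B, W ω ∂P = ∫⁻ ω in B, w n ω ∂P := by
    intro n B hB
    apply le_antisymm
    · refine (lintegral_liminf_le hwm').trans ?_
      refine (Tendsto.liminf_eq (tendsto_const_nhds.congr' ?_)).le
      filter_upwards [eventually_ge_atTop n] with k hk
      exact (hstep n k hk B hB).symm
    · have hle : ∀ k, n ≤ k → ∫⁻ ω in B, w n ω ∂P ≤ ∫⁻ ω in B, W ω ∂P + 2⁻¹ ^ k := by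
        intro k hk
        have hRk := hGm k _ (hR k)
        rw [← hstep n k hk B hB, ← lintegral_inter_add_sdiff _ B hRk, add_comm]
        refine add_le_add ?_ ?_
        · have e : ∫⁻ ω in B \ R k, w k ω ∂P = ∫⁻ ω in B \ R k, W ω ∂P :=
            setLIntegral_congr_fun ((hGm n _ hB).diff hRk) fun ω hω => (hW k ω hω.2).symm
          rw [e]
          exact lintegral_mono_set fun ω hω => hω.1
        · exact (lintegral_mono_set Set.inter_subset_right).trans (halive k)
      have hlim : Tendsto (fun k : ℕ => ∫⁻ ω in B, W ω ∂P + (2⁻¹ : ℝ≥0∞) ^ k) atTop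
          (nhds (∫⁻ ω in B, W ω ∂P + 0)) :=
        tendsto_const_nhds.add (ENNReal.tendsto_pow_atTop_nhds_zero_of_lt_one (by simp))
      rw [add_zero] at hlim
      exact ge_of_tendsto hlim (eventually_atTop.2 ⟨n, hle⟩)
  intro n g hg
  have hg' := hg.mono (hGm n) le_rfl
  have htrim : (P.withDensity W).trim (hGm n) = (P.withDensity (w n)).trim (hGm n) := by
    refine @Measure.ext _ (G n) _ _ fun B hB => ?_
    rw [trim_measurableSet_eq _ hB, trim_measurableSet_eq _ hB,
      withDensity_apply _ (hGm n _ hB), withDensity_apply _ (hGm n _ hB), hset n B hB]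
  have h1 := lintegral_trim (μ := P.withDensity W) (hGm n) hg
  rw [htrim, lintegral_trim (hGm n) hg, lintegral_withDensity_eq_lintegral_mul _ hWm hg',
    lintegral_withDensity_eq_lintegral_mul _ (hwm' n) hg'] at h1
  exact h1.symm

/-- Along an increasing family of `σ`-algebras, alive sets `R n` split into three events of
positive conditional probability, of which only the first two can be survived; positive weights
`a` with `a 0 + a 1 = a 2 = 1 / 2` can then be realised as conditional probabilities of these
events under a change of density. -/
lemma exists_split_densities {m : MeasurableSpace Ω} {P : Measure Ω} [IsProbabilityMeasure P]
    {G : ℕ → MeasurableSpace Ω} (hGm : ∀ n, G n ≤ m) (hG : Monotone G)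
    {R : ℕ → Set Ω} (hR : ∀ n, MeasurableSet[G n] (R n)) (hRanti : Antitone R)
    {E : ℕ → Fin 3 → Set Ω} (hE : ∀ n i, MeasurableSet[G (n + 1)] (E n i))
    (hER : ∀ n i, E n i ⊆ R n) (hsurv : ∀ n, Disjoint (R (n + 1)) (E n 2))
    (hpos : ∀ n i B, MeasurableSet[G n] B → B ⊆ R n → P (B ∩ E n i) = 0 → P B = 0) :
    ∃ ρ : ℕ → Fin 3 → Ω → ℝ≥0∞,
      (∀ᵐ ω ∂P, ∀ n i, ω ∈ E n i → 0 < ρ n i ω ∧ ρ n i ω < ∞) ∧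
      ∀ a : Fin 3 → ℝ≥0∞, a 0 + a 1 = 2⁻¹ → a 2 = 2⁻¹ →
        ∃ W : Ω → ℝ≥0∞, Measurable W ∧
          (∀ n, ∀ ω ∉ R n, W ω =
            ∏ k ∈ Finset.range n, stepDensity (R k) (E k) (ρ k) a ω) ∧
          ∀ n (g : Ω → ℝ≥0∞), Measurable[G n] g → ∫⁻ ω, W ω * g ω ∂P =
            ∫⁻ ω, (∏ k ∈ Finset.range n, stepDensity (R k) (E k) (ρ k) a ω) * g ω ∂P := by
  have hle : ∀ n, G n ≤ G (n + 1) := fun n => hG n.le_succ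
  choose ρ hρm hρint hρpos using fun n i => exists_conditional_weight (P := P) (hGm n) (hR n)
    (hGm _ _ (hE n i)) (hER n i) (hpos n i)
  have hRm := fun n => hGm n _ (hR n)
  have hEm := fun n i => hGm _ _ (hE n i)
  have hρm' := fun n i => (hρm n i).mono (hGm n) le_rfl
  refine ⟨ρ, ae_all_iff.2 fun n => ae_all_iff.2 fun i => hρpos n i, fun a ha hb => ?_⟩
  have hdm : ∀ n, Measurable[G (n + 1)] (stepDensity (R n) (E n) (ρ n) a) := fun n =>
    @measurable_stepDensity _ _ _ (G (n + 1)) _ _ _ (hle n _ (hR n)) (hE n)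
      (fun i => (hρm n i).mono (hle n) le_rfl) a
  have hlint : ∀ n (b : Fin 3 → ℝ≥0∞) (g : Ω → ℝ≥0∞), Measurable[G n] g →
      ∫⁻ ω, stepDensity (R n) (E n) (ρ n) b ω * g ω ∂P =
        ∫⁻ ω in (R n)ᶜ, g ω ∂P + (∑ i, b i) * ∫⁻ ω in R n, g ω ∂P := fun n b g hg =>
    lintegral_stepDensity_mul (hRm n) (hEm n) (hρm' n) b (hg.mono (hGm n) le_rfl)
      fun i => hρint n i g hg
  refine exists_limit_density hGm hG hR hRanti hdm ?_ ?_ ?_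
  · exact fun n ω hω => stepDensity_of_notMem (hER n) _ _ hω
  · intro n g hg
    rw [hlint n a g hg, Fin.sum_univ_three, ha, hb, ENNReal.inv_two_add_inv_two, one_mul, add_comm,
      lintegral_add_compl _ (hRm n)]
  · intro n g hg
    -- Survivors avoid `E n 2`, so its weight may be set to `0`; the remaining weights add up to
    -- `1/2`, which is the halving.
    have hbound : ∀ ω ∈ R (n + 1), stepDensity (R n) (E n) (ρ n) a ω * g ω =
        stepDensity (R n) (E n) (ρ n) ![a 0, a 1, 0] ω * (R n).indicator g ω := by
      intro ω hω
      have h2 : ω ∉ E n 2 := Set.disjoint_left.1 (hsurv n) hω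
      simp [stepDensity, Fin.sum_univ_three, h2, hRanti n.le_succ hω]
    rw [setLIntegral_congr_fun (hRm (n + 1)) hbound]
    refine (setLIntegral_le_lintegral _ _).trans ?_
    rw [hlint n _ _ (hg.indicator (hR n)), setLIntegral_indicator (hRm n),
      setLIntegral_indicator (hRm n)]
    simp [Fin.sum_univ_three, ha]

end Densities
-- Successive exit times and their outcomes
section Exit

variable {T : ℝ}

/-- The times from `a` on at which the path `x` has moved by at least `δ` from its position at
time `a`, together with the terminal time. -/
def exitSet (x : Set.Icc (0 : ℝ) T → ℝ) (δ : ℝ) (a : Set.Icc (0 : ℝ) T) : Set (Set.Icc (0 : ℝ) T) :=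
  {s | a ≤ s ∧ (δ ≤ |x s - x a| ∨ T ≤ s)}

lemma exists_isLeast_exitSet (hT : 0 ≤ T) {x : Set.Icc (0 : ℝ) T → ℝ} (hx : Continuous x) (δ : ℝ)
    (a : Set.Icc (0 : ℝ) T) : ∃ b, IsLeast (exitSet x δ a) b := by
  have hcl : IsClosed (exitSet x δ a) :=
    (isClosed_le continuous_const continuous_id).inter
      ((isClosed_le continuous_const (hx.sub continuous_const).abs).union
        (isClosed_le continuous_const continuous_subtype_val))
  exact hcl.isCompact.exists_isLeast ⟨⟨T, hT, le_rfl⟩, a.2.2, Or.inr le_rfl⟩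

lemma abs_sub_lt_of_lt_exit {x : Set.Icc (0 : ℝ) T → ℝ} {δ : ℝ} {a b s : Set.Icc (0 : ℝ) T}
    (hb : IsLeast (exitSet x δ a) b) (has : a ≤ s) (hsb : s < b) : |x s - x a| < δ := by
  by_contra h
  exact hsb.not_ge (hb.2 ⟨has, Or.inl (not_lt.1 h)⟩)

lemma abs_sub_le_of_le_exit {x : Set.Icc (0 : ℝ) T → ℝ} (hx : Continuous x) {δ : ℝ} (hδ : 0 < δ)
    {a b s : Set.Icc (0 : ℝ) T}
    (hb : IsLeast (exitSet x δ a) b) (has : a ≤ s) (hsb : s ≤ b) : |x s - x a| ≤ δ := by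
  rcases hb.1.1.eq_or_lt with h | h
  · have : s = a := le_antisymm (hsb.trans h.ge) has
    simp [this, hδ.le]
  · have hsub : Set.Ico a b ⊆ {s | |x s - x a| ≤ δ} := fun r hr =>
      (abs_sub_lt_of_lt_exit hb hr.1 hr.2).le
    have hcl := closure_minimal hsub
      (isClosed_le (hx.sub continuous_const).abs continuous_const)
    rw [closure_Ico h.ne] at hcl
    exact hcl ⟨has, hsb⟩

/-- Otherwise the exit times would increase to a limit while the path kept moving by at least `δ`
between consecutive ones, against continuity there. -/
lemma exists_exit_eq_top {x : Set.Icc (0 : ℝ) T → ℝ} (hx : Continuous x) {δ : ℝ} (hδ : 0 < δ)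
    {u : ℕ → Set.Icc (0 : ℝ) T} (hu : ∀ n, IsLeast (exitSet x δ (u n)) (u (n + 1))) :
    ∃ n, T ≤ u n := by
  by_contra! hcon
  have hmono : Monotone fun n => (u n : ℝ) := monotone_nat_of_le_succ fun n => (hu n).1.1
  obtain ⟨l, hl⟩ : ∃ l, Tendsto (fun n => (u n : ℝ)) atTop (nhds l) :=
    ⟨_, tendsto_atTop_ciSup hmono ⟨T, by rintro _ ⟨n, rfl⟩; exact (u n).2.2⟩⟩
  have hlmem : l ∈ Set.Icc (0 : ℝ) T :=
    isClosed_Icc.mem_of_tendsto hl (Eventually.of_forall fun n => (u n).2)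
  have hul : Tendsto u atTop (nhds ⟨l, hlmem⟩) := tendsto_subtype_rng.2 hl
  have hxl := (hx.tendsto ⟨l, hlmem⟩).comp hul
  have h0 := ((hxl.comp (tendsto_add_atTop_nat 1)).sub hxl).abs
  rw [sub_self, abs_zero] at h0
  refine absurd (ge_of_tendsto' h0 fun n => ?_) (not_le.2 hδ)
  exact (hu n).1.2.resolve_right (not_le.2 (hcon (n + 1)))

variable {Ω : Type*} {m : MeasurableSpace Ω} {𝓕 : Filtration (Set.Icc (0 : ℝ) T) m}
  {X : Set.Icc (0 : ℝ) T → Ω → ℝ} {τ σ : Ω → Set.Icc (0 : ℝ) T}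

/-- For `t < T`, exit by time `t` means that `τ ≤ t` and that the path frozen at `t` has not stayed
within `δ` on `[τ, t]`, which is decided by `𝓕 t`. -/
lemma isStoppingTime_exit (hX : ∀ ω, Continuous fun t => X t ω) (hXa : StronglyAdapted 𝓕 X)
    (hτ : IsStoppingTime 𝓕 (fun ω => (τ ω : WithTop (Set.Icc (0 : ℝ) T)))) {δ : ℝ}
    (hσ : ∀ ω, IsLeast (exitSet (fun t => X t ω) δ (τ ω)) (σ ω)) :
    IsStoppingTime 𝓕 (fun ω => (σ ω : WithTop (Set.Icc (0 : ℝ) T))) := by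
  rw [isStoppingTime_coe_iff]
  intro t
  rcases le_or_gt T t with ht | ht
  · convert @MeasurableSet.univ _ (𝓕 t)
    exact Set.eq_univ_iff_forall.2 fun ω => Subtype.coe_le_coe.1 ((σ ω).2.2.trans ht)
  · have h1 := @measurableSet_forall_Icc_lt T Ω (𝓕 t)
      (fun s ω => |X (min s t) ω - X (min (τ ω) t) ω|)
      (fun ω => (((hX ω).comp (by fun_prop)).sub continuous_const).abs)
      (fun s => continuous_abs.measurable.comp
        (((hXa (min s t)).mono (𝓕.mono (min_le_right _ _))).measurable.sub
          (measurable_process_min hX hXa hτ t)))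
      _ (fun _ => t) (measurable_min_const_of_isStoppingTime hτ t) measurable_const
      (fun ω => min_le_right _ _) δ
    convert (isStoppingTime_coe_iff.1 hτ t).inter h1.compl using 1
    ext ω
    simp only [Set.mem_inter_iff, Set.mem_compl_iff, Set.mem_ofPred_eq]
    constructor
    · intro hle
      have hτt := (hσ ω).1.1.trans hle
      refine ⟨hτt, fun H => ?_⟩
      have h2 := H (σ ω) ((min_le_left _ _).trans (hσ ω).1.1) hle
      rw [min_eq_left hle, min_eq_left hτt] at h2
      rcases (hσ ω).1.2 with h3 | h3
      · exact h2.not_ge h3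
      · exact (h3.trans (Subtype.coe_le_coe.2 hle)).not_gt ht
    · rintro ⟨hτt, H⟩
      push Not at H
      obtain ⟨s, h1, h2, h3⟩ := H
      rw [min_eq_left hτt] at h1 h3
      rw [min_eq_left h2] at h3
      exact ((hσ ω).2 ⟨h1, Or.inl h3⟩).trans h2

lemma exists_exit_sequence (hT : 0 ≤ T) (hX : ∀ ω, Continuous fun t => X t ω) (δ : ℝ) :
    ∃ τ : ℕ → Ω → Set.Icc (0 : ℝ) T, (∀ ω, τ 0 ω = ⟨0, le_rfl, hT⟩) ∧
      ∀ n ω, IsLeast (exitSet (fun t => X t ω) δ (τ n ω)) (τ (n + 1) ω) := by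
  choose e he using fun ω a => exists_isLeast_exitSet hT (hX ω) δ a
  exact ⟨fun n ω => Nat.rec ⟨0, le_rfl, hT⟩ (fun _ a => e ω a) n, fun ω => rfl,
    fun n ω => he ω _⟩

lemma measurableSet_inter_le_min_const (hT : 0 ≤ T)
    (hτ : IsStoppingTime 𝓕 (fun ω => (τ ω : WithTop (Set.Icc (0 : ℝ) T))))
    {s : Set.Icc (0 : ℝ) T}
    (hτ' : IsStoppingTime 𝓕 (fun ω => ((min (τ ω) s : Set.Icc (0 : ℝ) T) :
      WithTop (Set.Icc (0 : ℝ) T)))) {B : Set Ω}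
    (hB : MeasurableSet[hτ.measurableSpace] B) :
    MeasurableSet[hτ'.measurableSpace] (B ∩ {ω | τ ω ≤ s}) := by
  rw [measurableSet_stopping_iff hT] at hB ⊢
  intro t
  rcases le_total s t with h | h
  · convert 𝓕.mono h _ (hB s) using 1
    ext ω
    simp only [Set.mem_inter_iff, Set.mem_ofPred_eq]
    exact ⟨fun H => H.1, fun H => ⟨H, (min_le_right _ _).trans h⟩⟩
  · convert hB t using 1
    ext ω
    simp only [Set.mem_inter_iff, Set.mem_ofPred_eq]
    constructor
    · rintro ⟨⟨h1, h2⟩, h3⟩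
      exact ⟨h1, by rwa [min_eq_left h2] at h3⟩
    · rintro ⟨h1, h2⟩
      exact ⟨⟨h1, h2.trans h⟩, (min_le_left _ _).trans h2⟩

/-- Condition (A) concerns only stopping times bounded away from `T`. It is applied to `min τ s`
with `s < T`, which agrees with `τ` on `{τ ≤ s}`; a sequence of such `s` tending to `T` exhausts `{τ
< T}`. -/
lemma measure_eq_zero_of_before_terminal {P : Measure Ω} (hT : 0 < T)
    (hτ : IsStoppingTime 𝓕 (fun ω => (τ ω : WithTop (Set.Icc (0 : ℝ) T))))
    {A : (Ω → Set.Icc (0 : ℝ) T) → ℝ → Set Ω} {E B : Set Ω}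
    (hA : ∀ h : ℝ, 0 < h → h < T → ∀ π : Ω → Set.Icc (0 : ℝ) T,
      ∀ hπ : IsStoppingTime 𝓕 (fun ω => (π ω : WithTop (Set.Icc (0 : ℝ) T))),
      (∀ ω, (π ω : ℝ) < T - h) → CondPos P hπ.measurableSpace (A π h))
    (hAE : ∀ h : ℝ, 0 < h → ∀ π : Ω → Set.Icc (0 : ℝ) T, ∀ ω, (π ω : ℝ) < T - h →
      π ω = τ ω → ω ∈ A π h → ω ∈ E)
    (hB : MeasurableSet[hτ.measurableSpace] B) (hBT : ∀ ω ∈ B, (τ ω : ℝ) < T)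
    (h0 : P (B ∩ E) = 0) : P B = 0 := by
  have key : ∀ s : Set.Icc (0 : ℝ) T, (s : ℝ) < T → P (B ∩ {ω | τ ω ≤ s}) = 0 := by
    intro s hs
    have hπ : IsStoppingTime 𝓕 (fun ω => ((min (τ ω) s : Set.Icc (0 : ℝ) T) :
        WithTop (Set.Icc (0 : ℝ) T))) := by
      simpa using hτ.min_const s
    have hπT : ∀ ω, ((min (τ ω) s : Set.Icc (0 : ℝ) T) : ℝ) < T - (T - s) / 2 := fun ω => by
      have : ((min (τ ω) s : Set.Icc (0 : ℝ) T) : ℝ) ≤ s := Subtype.coe_le_coe.2 (min_le_right _ _)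
      linarith
    have hs0 := s.2.1
    refine hA ((T - s) / 2) (by linarith) (by linarith) _ hπ hπT _
      (measurableSet_inter_le_min_const hT.le hτ hπ hB) (measure_mono_null ?_ h0)
    rintro ω ⟨⟨h1, h2⟩, h3⟩
    exact ⟨h1, hAE ((T - s) / 2) (by linarith) _ ω (hπT ω) (min_eq_left h2) h3⟩
  let s : ℕ → Set.Icc (0 : ℝ) T := fun k => ⟨T - T * (1 / ((k : ℝ) + 1)), by
    have : 1 / ((k : ℝ) + 1) ≤ 1 := by
      rw [div_le_one (by positivity)]; linarith [(Nat.cast_nonneg k : (0 : ℝ) ≤ k)]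
    nlinarith, by
    have : 0 ≤ 1 / ((k : ℝ) + 1) := by positivity
    nlinarith⟩
  have hs : ∀ k, (s k : ℝ) < T := fun k => by
    have : 0 < T * (1 / ((k : ℝ) + 1)) := by positivity
    simp only [s]; linarith
  refine measure_mono_null (t := ⋃ k, B ∩ {ω | τ ω ≤ s k}) ?_
    (measure_iUnion_null fun k => key (s k) (hs k))
  intro ω hω
  obtain ⟨k, hk⟩ := exists_nat_one_div_lt (div_pos (sub_pos.2 (hBT ω hω)) hT)
  rw [lt_div_iff₀ hT] at hk
  refine Set.mem_iUnion.2 ⟨k, hω, show τ ω ≤ s k from Subtype.coe_le_coe.1 ?_⟩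
  simp only [s]; linarith

variable {P : Measure Ω} [IsProbabilityMeasure P]

/-- The events, for a path started at `τ < T`, of leaving through the top, through the bottom, and
of not leaving the band of half-width `δ` around its starting point by the time `σ`. -/
def exitEvent (X : Set.Icc (0 : ℝ) T → Ω → ℝ) (τ σ : Ω → Set.Icc (0 : ℝ) T) (δ : ℝ) :
    Fin 3 → Set Ω :=
  ![{ω | (τ ω : ℝ) < T ∧ δ ≤ X (σ ω) ω - X (τ ω) ω},
    {ω | (τ ω : ℝ) < T ∧ X (σ ω) ω - X (τ ω) ω ≤ -δ},
    {ω | (τ ω : ℝ) < T ∧ |X (σ ω) ω - X (τ ω) ω| < δ}]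

lemma ConditionA.measure_eq_zero_of_exitEvent (hT : 0 < T) (hX : ConditionA P 𝓕 X)
    (hτ : IsStoppingTime 𝓕 (fun ω => (τ ω : WithTop (Set.Icc (0 : ℝ) T)))) {δ : ℝ} (hδ : 0 < δ)
    (hσ : ∀ ω, IsLeast (exitSet (fun t => X t ω) δ (τ ω)) (σ ω)) (i : Fin 3) {B : Set Ω}
    (hB : MeasurableSet[hτ.measurableSpace] B) (hBT : ∀ ω ∈ B, (τ ω : ℝ) < T)
    (h0 : P (B ∩ exitEvent X τ σ δ i) = 0) : P B = 0 := by
  obtain ⟨hc, ha, H⟩ := (conditionA_iff hT.le).1 hX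
  -- At time `τ + h < T` the path lies below `-δ`, so the exit has occurred by then. Until then the
  -- path stays below `+δ`, so the exit is through the bottom.
  have hdown : ∀ (Y : Set.Icc (0 : ℝ) T → Ω → ℝ), (∀ ω, Continuous fun t => Y t ω) →
      (∀ ω, IsLeast (exitSet (fun t => Y t ω) δ (τ ω)) (σ ω)) →
      ∀ h : ℝ, 0 < h → ∀ π : Ω → Set.Icc (0 : ℝ) T, ∀ ω, (π ω : ℝ) < T - h →
      π ω = τ ω → ω ∈ downEvent Y π h δ δ → (τ ω : ℝ) < T ∧ Y (σ ω) ω - Y (τ ω) ω ≤ -δ := by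
    intro Y hY hσY h hh π ω hπT hπ hω
    rw [mem_downEvent_iff hY hT.le hh hπT, hπ] at hω
    rw [hπ] at hπT
    have h0 := (τ ω).2.1
    refine ⟨by linarith, ?_⟩
    let r : Set.Icc (0 : ℝ) T := ⟨(τ ω : ℝ) + h, by linarith, by linarith⟩
    have hr := hω.2 r le_rfl
    have hτr : τ ω ≤ r := Subtype.coe_le_coe.1 (by simp [r, hh.le])
    have hσr : σ ω ≤ r := (hσY ω).2 ⟨hτr, Or.inl ((by linarith : δ ≤ _).trans (neg_le_abs _))⟩
    have hσr' : (σ ω : ℝ) ≤ τ ω + h := hσr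
    have h1 := (hσY ω).1.2.resolve_right (by linarith)
    have h2 := hω.1 (σ ω) (hσY ω).1.1 hσr
    rcases le_abs.1 h1 with h3 | h3
    · linarith
    · linarith
  fin_cases i
  · refine measure_eq_zero_of_before_terminal hT hτ (A := fun π h => upEvent X π h δ δ)
      (fun h hh hhT π hπ hπT => (H h hh hhT π hπ hπT δ hδ δ hδ).2.2) ?_ hB hBT h0
    intro h hh π ω hπT hπ hω
    rw [upEvent_eq_downEvent_neg] at hω
    have h1 := hdown (fun t ω => -X t ω) (fun ω => (hc ω).neg) (fun ω => by
      have e : exitSet (fun t => -X t ω) δ (τ ω) = exitSet (fun t => X t ω) δ (τ ω) := by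
        ext s
        simp only [exitSet, Set.mem_ofPred_eq]
        rw [← abs_neg, show -(-X s ω - -X (τ ω) ω) = X s ω - X (τ ω) ω by ring]
      rw [e]; exact hσ ω) h hh π ω hπT hπ hω
    exact ⟨h1.1, by linarith [h1.2]⟩
  · exact measure_eq_zero_of_before_terminal hT hτ (A := fun π h => downEvent X π h δ δ)
      (fun h hh hhT π hπ hπT => (H h hh hhT π hπ hπT δ hδ δ hδ).2.1) (hdown X hc hσ) hB hBT h0
  · refine measure_eq_zero_of_before_terminal hT hτ (A := fun π _ => stayEvent X π δ)
      (fun h hh hhT π hπ hπT => (H h hh hhT π hπ hπT δ hδ δ hδ).1) ?_ hB hBT h0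
    intro h hh π ω hπT hπ hω
    have hπT' : (π ω : ℝ) < T := by linarith
    rw [mem_stayEvent_iff hc hT.le hπT', hπ] at hω
    rw [hπ] at hπT'
    exact ⟨hπT', hω _ (hσ ω).1.1⟩

end Exit
-- The pair of densities built from the exit outcomes
section ExitDensity

open scoped ENNReal

variable {T : ℝ} {Ω : Type*}

lemma exitEvent_subset (X : Set.Icc (0 : ℝ) T → Ω → ℝ) (τ σ : Ω → Set.Icc (0 : ℝ) T) (δ : ℝ)
    (i : Fin 3) : exitEvent X τ σ δ i ⊆ {ω | (τ ω : ℝ) < T} := by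
  fin_cases i <;> exact fun ω hω => hω.1

lemma exists_mem_exitEvent {X : Set.Icc (0 : ℝ) T → Ω → ℝ} {τ σ : Ω → Set.Icc (0 : ℝ) T} (δ : ℝ)
    {ω : Ω} (hω : (τ ω : ℝ) < T) : ∃ i, ω ∈ exitEvent X τ σ δ i := by
  rcases lt_or_ge |X (σ ω) ω - X (τ ω) ω| δ with h | h
  · exact ⟨2, hω, h⟩
  · rcases le_abs.1 h with h | h
    · exact ⟨0, hω, h⟩
    · exact ⟨1, hω, by linarith⟩

lemma pairwise_disjoint_exitEvent (X : Set.Icc (0 : ℝ) T → Ω → ℝ) (τ σ : Ω → Set.Icc (0 : ℝ) T)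
    {δ : ℝ} (hδ : 0 < δ) :
    Pairwise fun i j => Disjoint (exitEvent X τ σ δ i) (exitEvent X τ σ δ j) := by
  have h01 : Disjoint (exitEvent X τ σ δ 0) (exitEvent X τ σ δ 1) :=
    Set.disjoint_left.2 fun ω h0 h1 => by
      have a := h0.2
      have b := h1.2
      linarith
  have h02 : Disjoint (exitEvent X τ σ δ 0) (exitEvent X τ σ δ 2) :=
    Set.disjoint_left.2 fun ω h0 h2 => by
      have a := h0.2
      have b := (abs_lt.1 h2.2).2
      linarith
  have h12 : Disjoint (exitEvent X τ σ δ 1) (exitEvent X τ σ δ 2) :=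
    Set.disjoint_left.2 fun ω h1 h2 => by
      have a := h1.2
      have b := (abs_lt.1 h2.2).1
      linarith
  intro i j hij
  fin_cases i <;> fin_cases j <;>
    first
    | exact absurd rfl hij
    | exact h01
    | exact h02
    | exact h12
    | exact h01.symm
    | exact h02.symm
    | exact h12.symm

lemma measurableSet_exitEvent {m' : MeasurableSpace Ω} {X : Set.Icc (0 : ℝ) T → Ω → ℝ}
    {τ σ : Ω → Set.Icc (0 : ℝ) T} (hR : MeasurableSet {ω | (τ ω : ℝ) < T})
    (hτ : Measurable fun ω => X (τ ω) ω) (hσ : Measurable fun ω => X (σ ω) ω) (δ : ℝ) (i : Fin 3) :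
    MeasurableSet (exitEvent X τ σ δ i) := by
  have hd := hσ.sub hτ
  fin_cases i
  · exact hR.inter (hd measurableSet_Ici)
  · exact hR.inter (hd measurableSet_Iic)
  · exact hR.inter ((continuous_abs.measurable.comp hd) measurableSet_Iio)

lemma stepDensity_pos_lt_top {ι : Type*} [Fintype ι] {R : Set Ω} {E : ι → Set Ω}
    (hER : ∀ i, E i ⊆ R) (hd : Pairwise fun i j => Disjoint (E i) (E j))
    {ρ : ι → Ω → ℝ≥0∞} {a : ι → ℝ≥0∞} (ha : ∀ i, 0 < a i ∧ a i < ∞) {ω : Ω}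
    (hcover : ω ∈ R → ∃ i, ω ∈ E i) (hρ : ∀ i, ω ∈ E i → 0 < ρ i ω ∧ ρ i ω < ∞) :
    0 < stepDensity R E ρ a ω ∧ stepDensity R E ρ a ω < ∞ := by
  by_cases hω : ω ∈ R
  · obtain ⟨i, hi⟩ := hcover hω
    rw [stepDensity_of_mem hER hd ρ a hi]
    exact ⟨ENNReal.mul_pos (ha i).1.ne' (hρ i hi).1.ne', ENNReal.mul_lt_top (ha i).2 (hρ i hi).2⟩
  · rw [stepDensity_of_notMem hER ρ a hω]
    exact ⟨one_pos, ENNReal.one_lt_top⟩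

lemma stepDensity_le_mul {R : Set Ω} {E : Fin 3 → Set Ω}
    (hER : ∀ i, E i ⊆ R) (hd : Pairwise fun i j => Disjoint (E i) (E j))
    (ρ : Fin 3 → Ω → ℝ≥0∞) {κ : ℝ≥0∞} {a b : Fin 3 → ℝ≥0∞} (hab : ∀ i, a i ≤ κ * b i)
    {ω : Ω} (hcover : ∃ i, ω ∈ E i) :
    stepDensity R E ρ a ω ≤ κ * stepDensity R E ρ b ω := by
  obtain ⟨i, hi⟩ := hcover
  rw [stepDensity_of_mem hER hd ρ a hi, stepDensity_of_mem hER hd ρ b hi, ← mul_assoc]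
  gcongr
  exact hab i

lemma ofReal_exp_le_of_abs_sub_le {x y δ : ℝ} (h : |x - y| ≤ δ) :
    ENNReal.ofReal (Real.exp x) ≤ ENNReal.ofReal (Real.exp δ) * ENNReal.ofReal (Real.exp y) := by
  rw [← ENNReal.ofReal_mul (Real.exp_pos _).le, ← Real.exp_add]
  exact ENNReal.ofReal_le_ofReal (Real.exp_le_exp.2 (by linarith [(abs_le.1 h).2]))

variable {m : MeasurableSpace Ω} {𝓕 : Filtration (Set.Icc (0 : ℝ) T) m}
  {X : Set.Icc (0 : ℝ) T → Ω → ℝ} {P : Measure Ω} [IsProbabilityMeasure P]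

/-- Under condition (A) there are two densities whose ratio, multiplied by `exp X₀`, has
conditional expectations comparable to `exp Xₜ`, up to a factor `exp (2δ)`. -/
lemma ConditionA.exists_density_pair (hT : 0 < T) (hX : ConditionA P 𝓕 X) {δ : ℝ} (hδ : 0 < δ) :
    ∃ D N : Ω → ℝ≥0∞, Measurable D ∧ Measurable N ∧
      (∀ᵐ ω ∂P, 0 < D ω ∧ D ω < ∞) ∧ (∀ᵐ ω ∂P, N ω < ∞) ∧ ∫⁻ ω, D ω ∂P = 1 ∧
      ∫⁻ ω, N ω * ENNReal.ofReal (Real.exp (X ⟨0, le_rfl, hT.le⟩ ω)) ∂P =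
        ∫⁻ ω, ENNReal.ofReal (Real.exp (X ⟨0, le_rfl, hT.le⟩ ω)) ∂P ∧
      ∀ t, ∃ C : ℕ → Set Ω, (∀ n, MeasurableSet[𝓕 t] (C n)) ∧ (∀ ω, ∃ n, ω ∈ C n) ∧
        ∀ n B, MeasurableSet[𝓕 t] B → B ⊆ C n →
          ∫⁻ ω in B, N ω * ENNReal.ofReal (Real.exp (X ⟨0, le_rfl, hT.le⟩ ω)) ∂P ≤
            ENNReal.ofReal (Real.exp (2 * δ)) *
              ∫⁻ ω in B, D ω * ENNReal.ofReal (Real.exp (X t ω)) ∂P ∧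
          ∫⁻ ω in B, D ω * ENNReal.ofReal (Real.exp (X t ω)) ∂P ≤
            ENNReal.ofReal (Real.exp (2 * δ)) *
              ∫⁻ ω in B, N ω * ENNReal.ofReal (Real.exp (X ⟨0, le_rfl, hT.le⟩ ω)) ∂P := by
  have hc := hX.continuous
  have hXa := hX.adapted
  obtain ⟨τ, hτ0, hτs⟩ := exists_exit_sequence hT.le hc δ
  have hτ : ∀ n, IsStoppingTime 𝓕 (fun ω => (τ n ω : WithTop (Set.Icc (0 : ℝ) T))) := by
    intro n
    induction n with
    | zero => simpa only [hτ0] using isStoppingTime_const 𝓕 _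
    | succ n ih => exact isStoppingTime_exit hc hXa ih (hτs n)
  have hmonoτ : ∀ ω, Monotone fun n => τ n ω := fun ω =>
    monotone_nat_of_le_succ fun n => (hτs n ω).1.1
  set G : ℕ → MeasurableSpace Ω := fun n => (hτ n).measurableSpace with hGdef
  have hGm : ∀ n, G n ≤ m := fun n => (hτ n).measurableSpace_le
  have hG : Monotone G := fun i j hij => (hτ i).measurableSpace_mono (hτ j) fun ω =>
    WithTop.coe_le_coe.2 (hmonoτ ω hij)
  have hXτ : ∀ n, Measurable[G n] fun ω => X (τ n ω) ω := fun n =>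
    measurable_process_at_stopping hT.le hc hXa (hτ n)
  set R : ℕ → Set Ω := fun n => {ω | (τ n ω : ℝ) < T} with hRdef
  have hR : ∀ n, MeasurableSet[G n] (R n) := by
    intro n
    have h1 : MeasurableSet[G n] (R n)ᶜ :=
      measurableSet_of_subset_ge hT.le (hτ n) (t := ⟨T, hT.le, le_rfl⟩) (by
        have : (R n)ᶜ = (fun ω => min (τ n ω) (⟨T, hT.le, le_rfl⟩ : Set.Icc (0 : ℝ) T)) ⁻¹'
            Set.Ici ⟨T, hT.le, le_rfl⟩ := by
          ext ω
          simp [hRdef, ← Subtype.coe_le_coe]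
        rw [this]
        exact measurable_min_const_of_isStoppingTime (hτ n) _ measurableSet_Ici)
        fun ω hω => Subtype.coe_le_coe.1 (not_lt.1 hω)
    simpa using h1.compl
  have hRanti : Antitone R := fun i j hij ω hω =>
    lt_of_le_of_lt (Subtype.coe_le_coe.2 (hmonoτ ω hij)) hω
  set E : ℕ → Fin 3 → Set Ω := fun n => exitEvent X (τ n) (τ (n + 1)) δ with hEdef
  have hE : ∀ n i, MeasurableSet[G (n + 1)] (E n i) := fun n i =>
    @measurableSet_exitEvent T Ω (G (n + 1)) X _ _ (hG n.le_succ _ (hR n))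
      ((hXτ n).mono (hG n.le_succ) le_rfl) (hXτ (n + 1)) δ i
  have hER : ∀ n i, E n i ⊆ R n := fun n i => exitEvent_subset X _ _ δ i
  have hdisj : ∀ n, Pairwise fun i j => Disjoint (E n i) (E n j) := fun n =>
    pairwise_disjoint_exitEvent X _ _ hδ
  have hcover : ∀ n, ∀ ω ∈ R n, ∃ i, ω ∈ E n i := fun n ω hω => exists_mem_exitEvent δ hω
  have hmove : ∀ n, ∀ ω ∈ R (n + 1), δ ≤ |X (τ (n + 1) ω) ω - X (τ n ω) ω| := fun n ω hω =>
    (hτs n ω).1.2.resolve_right (not_le.2 hω)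
  have hsurv : ∀ n, Disjoint (R (n + 1)) (E n 2) := fun n =>
    Set.disjoint_left.2 fun ω h1 h2 => (hmove n ω h1).not_gt h2.2
  have hpos : ∀ n i B, MeasurableSet[G n] B → B ⊆ R n → P (B ∩ E n i) = 0 → P B = 0 :=
    fun n i B hB hBR h0 =>
      hX.measure_eq_zero_of_exitEvent hT (hτ n) hδ (hτs n) i hB hBR h0
  obtain ⟨ρ, hρ, hdens⟩ := exists_split_densities hGm hG hR hRanti hE hER hsurv hpos
  set κ := ENNReal.ofReal (Real.exp δ) with hκ
  have hκ1 : 1 ≤ κ := by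
    rw [hκ, ← ENNReal.ofReal_one]
    exact ENNReal.ofReal_le_ofReal (Real.one_le_exp hδ.le)
  have hκtop : κ < ∞ := ENNReal.ofReal_lt_top
  obtain ⟨q, hq0, hqtop, hq⟩ : ∃ q : ℝ≥0∞, 0 < q ∧ q < ∞ ∧ q + q * κ = 2⁻¹ := by
    have h0 : 1 + κ ≠ 0 := by simp
    have h1 : 1 + κ ≠ ∞ := ENNReal.add_ne_top.2 ⟨ENNReal.one_ne_top, hκtop.ne⟩
    refine ⟨2⁻¹ * (1 + κ)⁻¹, ENNReal.mul_pos (by simp) (by simpa using hκtop.ne),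
      ENNReal.mul_lt_top (by simp) (by simp), ?_⟩
    rw [← mul_one_add, mul_assoc, ENNReal.inv_mul_cancel h0 h1, mul_one]
  have hqκ : 0 < q * κ ∧ q * κ < ∞ :=
    ⟨ENNReal.mul_pos hq0.ne' (one_pos.trans_le hκ1).ne', ENNReal.mul_lt_top hqtop hκtop⟩
  -- Swapping the up and down weights gives `b / a = κ` on an up exit and `κ⁻¹` on a down exit,
  -- exactly the factor by which `exp X` changes.
  set a : Fin 3 → ℝ≥0∞ := ![q, q * κ, 2⁻¹] with ha
  set b : Fin 3 → ℝ≥0∞ := ![q * κ, q, 2⁻¹] with hb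
  have hapos : ∀ i, 0 < a i ∧ a i < ∞ := by
    intro i; fin_cases i
    · exact ⟨hq0, hqtop⟩
    · exact hqκ
    · simp [ha]
  have hbpos : ∀ i, 0 < b i ∧ b i < ∞ := by
    intro i; fin_cases i
    · exact hqκ
    · exact ⟨hq0, hqtop⟩
    · simp [hb]
  have hκle : ∀ x : ℝ≥0∞, x ≤ κ * x := fun x => le_mul_of_one_le_left' hκ1
  have hab : ∀ i, a i ≤ κ * b i := by
    intro i; fin_cases i
    · exact (hκle q).trans (mul_le_mul_right (show q ≤ q * κ by rw [mul_comm]; exact hκle q) κ)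
    · exact (mul_comm q κ).le
    · exact hκle _
  have hba : ∀ i, b i ≤ κ * a i := by
    intro i; fin_cases i
    · exact (mul_comm q κ).le
    · exact (hκle q).trans (mul_le_mul_right (show q ≤ q * κ by rw [mul_comm]; exact hκle q) κ)
    · exact hκle _
  obtain ⟨D, hDm, hDR, hDint⟩ := hdens a hq rfl
  obtain ⟨N, hNm, hNR, hNint⟩ := hdens b (by rw [← hq, add_comm]; rfl) rfl
  set dens : (Fin 3 → ℝ≥0∞) → ℕ → Ω → ℝ≥0∞ := fun c n ω =>
    ∏ k ∈ Finset.range n, stepDensity (R k) (E k) (ρ k) c ω with hdensdef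
  have hdead : ∀ ω, ∃ n, ω ∉ R n := fun ω => by
    obtain ⟨n, hn⟩ := exists_exit_eq_top (hc ω) hδ fun n => hτs n ω
    exact ⟨n, not_lt.2 hn⟩
  have hprod : ∀ c : Fin 3 → ℝ≥0∞, (∀ i, 0 < c i ∧ c i < ∞) →
      ∀ᵐ ω ∂P, ∀ n, 0 < dens c n ω ∧ dens c n ω < ∞ := by
    intro c hc
    filter_upwards [hρ] with ω hω n
    have h1 := fun k => stepDensity_pos_lt_top (hER k) (hdisj k) hc (hcover k ω) (hω k)
    exact ⟨CanonicallyOrderedAdd.prod_pos.2 fun k _ => (h1 k).1,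
      ENNReal.prod_lt_top fun k _ => (h1 k).2⟩
  set Y : Set.Icc (0 : ℝ) T → Ω → ℝ≥0∞ := fun t ω => ENNReal.ofReal (Real.exp (X t ω)) with hY
  have hYτ : ∀ n, Measurable[G n] fun ω => Y (τ n ω) ω := fun n =>
    (ENNReal.measurable_ofReal.comp Real.measurable_exp).comp (hXτ n)
  have hratio : ∀ n, ∀ ω ∈ R n, dens b n ω * Y (τ 0 ω) ω = dens a n ω * Y (τ n ω) ω := by
    intro n ω hω
    induction n with
    | zero => simp [hdensdef]
    | succ n ih =>
      have hωn : ω ∈ R n := hRanti n.le_succ hω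
      -- Continuity rules out overshoot: with `hmove`, the increment is exactly `δ` or `-δ`.
      have hle := abs_le.1
        (abs_sub_le_of_le_exit (hc ω) hδ (hτs n ω) (hτs n ω).1.1 le_rfl)
      have hstep : stepDensity (R n) (E n) (ρ n) b ω * Y (τ n ω) ω =
          stepDensity (R n) (E n) (ρ n) a ω * Y (τ (n + 1) ω) ω := by
        rcases le_abs.1 (hmove n ω hω) with h | h
        · have hmem : ω ∈ E n 0 := ⟨hωn, h⟩
          have hY1 : Y (τ (n + 1) ω) ω = κ * Y (τ n ω) ω := by
            simp only [hY, hκ]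
            rw [← ENNReal.ofReal_mul (Real.exp_pos _).le, ← Real.exp_add]
            congr 2
            linarith [hle.2]
          rw [stepDensity_of_mem (hER n) (hdisj n) _ _ hmem,
            stepDensity_of_mem (hER n) (hdisj n) _ _ hmem, hY1]
          simp only [ha, hb, Matrix.cons_val_zero]
          ring
        · have hmem : ω ∈ E n 1 := ⟨hωn, by linarith⟩
          have hY1 : Y (τ n ω) ω = κ * Y (τ (n + 1) ω) ω := by
            simp only [hY, hκ]
            rw [← ENNReal.ofReal_mul (Real.exp_pos _).le, ← Real.exp_add]
            congr 2
            linarith [hle.1]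
          rw [stepDensity_of_mem (hER n) (hdisj n) _ _ hmem,
            stepDensity_of_mem (hER n) (hdisj n) _ _ hmem, hY1]
          simp only [ha, hb, Matrix.cons_val_one, Matrix.cons_val_zero]
          ring
      simp only [hdensdef, Finset.prod_range_succ] at ih ⊢
      rw [mul_right_comm, ih hωn, mul_assoc, mul_assoc, mul_comm (Y _ _), hstep]
  have hτ0' : ∀ ω, Y (τ 0 ω) ω = Y ⟨0, le_rfl, hT.le⟩ ω := fun ω => by rw [hτ0]
  have hκ2 : ENNReal.ofReal (Real.exp (2 * δ)) = κ * κ := by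
    rw [hκ, ← ENNReal.ofReal_mul (Real.exp_pos _).le, ← Real.exp_add, two_mul]
  refine ⟨D, N, hDm, hNm, ?_, ?_, ?_, ?_, ?_⟩
  · filter_upwards [hprod a hapos] with ω hω
    obtain ⟨n, hn⟩ := hdead ω
    rw [hDR n ω hn]
    exact hω n
  · filter_upwards [hprod b hbpos] with ω hω
    obtain ⟨n, hn⟩ := hdead ω
    rw [hNR n ω hn]
    exact (hω n).2
  · simpa using hDint 0 (fun _ => 1) measurable_const
  · have h : ∫⁻ ω, N ω * Y (τ 0 ω) ω ∂P = ∫⁻ ω, Y (τ 0 ω) ω ∂P := by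
      simpa using hNint 0 _ (hYτ 0)
    simpa only [hτ0'] using h
  · intro t
    have hbefore : ∀ n, MeasurableSet[𝓕 t] {ω | τ n ω ≤ t ∧ (τ n ω : ℝ) < T} := by
      intro n
      have h1 := measurable_min_const_of_isStoppingTime (hτ n) t
      have h2 : {ω | τ n ω ≤ t ∧ (τ n ω : ℝ) < T} =
          {ω | τ n ω ≤ t} ∩ (fun ω => min (τ n ω) t) ⁻¹' Set.Iio ⟨T, hT.le, le_rfl⟩ := by
        ext ω
        simp only [Set.mem_ofPred_eq, Set.mem_inter_iff, Set.mem_preimage, Set.mem_Iio]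
        refine and_congr_right fun h => ?_
        rw [min_eq_left h]
        rfl
      rw [h2]
      exact (isStoppingTime_coe_iff.1 (hτ n) t).inter (h1 measurableSet_Iio)
    -- The `n`-th piece says that `t` falls in the `n`-th step. The condition `τ < T` puts `t = T`
    -- in the last step begun before `T`.
    refine ⟨fun n => {ω | τ n ω ≤ t ∧ (τ n ω : ℝ) < T} \
      {ω | τ (n + 1) ω ≤ t ∧ (τ (n + 1) ω : ℝ) < T},
      fun n => (hbefore n).diff (hbefore (n + 1)), ?_, ?_⟩
    · intro ω
      by_contra! hcon
      have hall : ∀ n, τ n ω ≤ t ∧ (τ n ω : ℝ) < T := by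
        intro n
        induction n with
        | zero => rw [hτ0]; exact ⟨t.2.1, hT⟩
        | succ n ih =>
          by_contra h
          exact hcon n ⟨ih, h⟩
      obtain ⟨n, hn⟩ := hdead ω
      exact hn (hall n).2
    · intro n B hB hBC
      have hge : ∀ ω ∈ B, t ≤ τ (n + 1) ω := by
        intro ω hω
        by_contra! h
        exact (hBC hω).2 ⟨h.le, lt_of_lt_of_le (Subtype.coe_lt_coe.2 h) t.2.2⟩
      have hBG : MeasurableSet[G (n + 1)] B := measurableSet_of_subset_ge hT.le (hτ (n + 1)) hB hge
      have hBm := 𝓕.le t _ hB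
      have hYtB : Measurable[G (n + 1)] (B.indicator (Y t)) := by
        have h1 : Measurable[𝓕 t] (B.indicator (Y t)) :=
          ((ENNReal.measurable_ofReal.comp Real.measurable_exp).comp
            (hXa t).measurable).indicator hB
        -- The indicator vanishes off `B`, so its preimages of the sets `Ioi x` lie in `B`, where `t
        -- ≤ τ (n + 1)`; there an `𝓕 t`-event is known at `τ (n + 1)`.
        refine @measurable_of_Ioi _ _ _ _ _ (G (n + 1)) _ _ _ _ fun x => ?_
        have h2 := h1 (measurableSet_Ioi (a := x))
        refine measurableSet_of_subset_ge hT.le (hτ (n + 1)) h2 fun ω hω => hge ω ?_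
        by_contra hωB
        simp [hωB] at hω
      have hconv : ∀ (W g : Ω → ℝ≥0∞) (c : Fin 3 → ℝ≥0∞),
          (∀ n (g : Ω → ℝ≥0∞), Measurable[G n] g →
            ∫⁻ ω, W ω * g ω ∂P = ∫⁻ ω, dens c n ω * g ω ∂P) →
          Measurable[G (n + 1)] (B.indicator g) →
          ∫⁻ ω in B, W ω * g ω ∂P = ∫⁻ ω in B, dens c (n + 1) ω * g ω ∂P := by
        intro W g c hW hg
        have h1 := hW (n + 1) _ hg
        rw [← lintegral_indicator hBm, ← lintegral_indicator hBm]
        convert h1 using 3 with ω ω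
        · by_cases hω : ω ∈ B <;> simp [hω]
        · by_cases hω : ω ∈ B <;> simp [hω]
      have hN1 := hconv N (fun ω => Y (τ 0 ω) ω) b hNint
        (((hYτ 0).mono (hG (Nat.zero_le _)) le_rfl).indicator hBG)
      have hD1 := hconv D (Y t) a hDint hYtB
      simp only [hτ0'] at hN1
      rw [hN1, hD1, hκ2, ← lintegral_const_mul' _ _ (ENNReal.mul_lt_top hκtop hκtop).ne,
        ← lintegral_const_mul' _ _ (ENNReal.mul_lt_top hκtop hκtop).ne]
      -- Both bounds start from the exact ratio at `τ n`: one factor `κ` pays for passing between `τ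
      -- n` and `t`, the other for comparing the weights `a` and `b` of step `n`.
      have hnear : ∀ ω ∈ B, ω ∈ R n ∧ |X t ω - X (τ n ω) ω| ≤ δ := fun ω hω =>
        ⟨(hBC hω).1.2, abs_sub_le_of_le_exit (hc ω) hδ (hτs n ω) (hBC hω).1.1 (hge ω hω)⟩
      constructor
      · refine setLIntegral_mono' hBm fun ω hω => ?_
        obtain ⟨h1, h2⟩ := hnear ω hω
        have h3 := hratio n ω h1
        rw [hτ0'] at h3
        have h4 := stepDensity_le_mul (hER n) (hdisj n) (ρ n) hba (hcover n ω h1)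
        have h5 : Y (τ n ω) ω ≤ κ * Y t ω := ofReal_exp_le_of_abs_sub_le (by rwa [abs_sub_comm])
        simp only [hdensdef, Finset.prod_range_succ] at h3 ⊢
        rw [mul_right_comm, h3]
        refine (mul_le_mul' (mul_le_mul' le_rfl h5) h4).trans (le_of_eq ?_)
        ring
      · refine setLIntegral_mono' hBm fun ω hω => ?_
        obtain ⟨h1, h2⟩ := hnear ω hω
        have h3 := hratio n ω h1
        rw [hτ0'] at h3
        have h4 := stepDensity_le_mul (hER n) (hdisj n) (ρ n) hab (hcover n ω h1)
        have h5 : Y t ω ≤ κ * Y (τ n ω) ω := ofReal_exp_le_of_abs_sub_le h2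
        simp only [hdensdef, Finset.prod_range_succ] at h3 ⊢
        rw [mul_right_comm _ _ (Y _ ω), mul_right_comm _ _ (Y _ ω), h3]
        refine (mul_le_mul' (mul_le_mul' le_rfl h5) h4).trans (le_of_eq ?_)
        ring

end ExitDensity
-- From the densities to a consistent price system
section PriceSystem

open scoped ENNReal

variable {Ω : Type*}

lemma setLIntegral_ofReal_condExp {m' m : MeasurableSpace Ω} (hm : m' ≤ m) {Q : Measure Ω}
    [IsFiniteMeasure Q] {f : Ω → ℝ} (hf : Integrable f Q) (h0 : ∀ ω, 0 ≤ f ω) {B : Set Ω}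
    (hB : MeasurableSet[m'] B) :
    ∫⁻ ω in B, ENNReal.ofReal ((Q[f | m']) ω) ∂Q = ∫⁻ ω in B, ENNReal.ofReal (f ω) ∂Q := by
  rw [← ofReal_integral_eq_lintegral_ofReal integrable_condExp.integrableOn
      (ae_restrict_of_ae (condExp_nonneg (Eventually.of_forall h0))),
    ← ofReal_integral_eq_lintegral_ofReal hf.integrableOn (Eventually.of_forall h0),
    setIntegral_condExp hm hf hB]

lemma ae_le_of_setLIntegral_le_on_cover {m' m : MeasurableSpace Ω} (hm : m' ≤ m) {Q : Measure Ω}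
    [IsFiniteMeasure Q] {u v : Ω → ℝ≥0∞} (hu : Measurable[m'] u) (hv : Measurable[m'] v)
    {C : ℕ → Set Ω} (hC : ∀ n, MeasurableSet[m'] (C n)) (hcover : ∀ ω, ∃ n, ω ∈ C n)
    (h : ∀ n B, MeasurableSet[m'] B → B ⊆ C n → ∫⁻ ω in B, u ω ∂Q ≤ ∫⁻ ω in B, v ω ∂Q) :
    ∀ᵐ ω ∂Q, u ω ≤ v ω := by
  have key : ∀ n, ∀ᵐ ω ∂Q, (C n).indicator u ω ≤ (C n).indicator v ω := by
    intro n
    have htrim : ∀ w : Ω → ℝ≥0∞, Measurable[m'] w → ∀ B, MeasurableSet[m'] B →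
        ∫⁻ ω in B, (C n).indicator w ω ∂(Q.trim hm) = ∫⁻ ω in C n ∩ B, w ω ∂Q := by
      intro w hw B hB
      rw [restrict_trim hm Q hB, lintegral_trim hm (hw.indicator (hC n)),
        setLIntegral_indicator (hm _ (hC n))]
    refine ae_of_ae_trim hm ?_
    refine @ae_le_of_forall_setLIntegral_le_of_sigmaFinite Ω m' (Q.trim hm) _ _ _
      (hu.indicator (hC n)) fun B hB _ => ?_
    rw [htrim u hu B hB, htrim v hv B hB]
    exact h n _ ((hC n).inter hB) Set.inter_subset_left
  filter_upwards [ae_all_iff.2 key] with ω hω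
  obtain ⟨n, hn⟩ := hcover ω
  simpa [hn] using hω n

variable {T : ℝ} {m : MeasurableSpace Ω} {𝓕 : Filtration (Set.Icc (0 : ℝ) T) m} {P : Measure Ω}

/-- To find a consistent price system it suffices to bound the conditional expectations of a
terminal value at each fixed time: truncating them at the bounds gives versions for which the
bounds hold at all times simultaneously. -/
lemma AdmitsCPS.of_condExp_bounds {Y : Set.Icc (0 : ℝ) T → Ω → ℝ} {ε : ℝ} (hε : 0 < ε)
    (hYa : StronglyAdapted 𝓕 Y) (hY0 : ∀ t ω, 0 < Y t ω) {Q : Measure Ω} [IsProbabilityMeasure Q]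
    (hQP : Q ≪ P) (hPQ : P ≪ Q) {M : Ω → ℝ}
    (hM : ∀ t, ∀ᵐ ω ∂Q, (1 + ε)⁻¹ * Y t ω ≤ (Q[M | 𝓕 t]) ω ∧ (Q[M | 𝓕 t]) ω ≤ (1 + ε) * Y t ω) :
    AdmitsCPS P 𝓕 Y ε := by
  let Z : Set.Icc (0 : ℝ) T → Ω → ℝ := fun t ω =>
    max ((1 + ε)⁻¹ * Y t ω) (min ((1 + ε) * Y t ω) ((Q[M | 𝓕 t]) ω))
  have hZ : ∀ t, Z t =ᵐ[Q] Q[M | 𝓕 t] := fun t => by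
    filter_upwards [hM t] with ω hω
    simp only [Z, min_eq_right hω.2, max_eq_right hω.1]
  have hle : ∀ t ω, (1 + ε)⁻¹ * Y t ω ≤ (1 + ε) * Y t ω := fun t ω => by
    have h1 : (1 + ε)⁻¹ ≤ 1 := inv_le_one_of_one_le₀ (by linarith)
    exact mul_le_mul_of_nonneg_right (by linarith) (hY0 t ω).le
  refine ⟨hYa, hY0, Q, inferInstance, hQP, hPQ, Z, ⟨fun t => ?_, fun s t hst => ?_⟩, ?_⟩
  · have h1 : ∀ a : ℝ, Measurable[𝓕 t] fun ω => a * Y t ω := fun a => (hYa t).measurable.const_mul a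
    exact (@Measurable.max _ _ _ _ _ (𝓕 t) _ _ _ _ _ (h1 _)
      (@Measurable.min _ _ _ _ _ (𝓕 t) _ _ _ _ _ (h1 _)
        stronglyMeasurable_condExp.measurable)).stronglyMeasurable
  · exact (condExp_congr_ae (hZ t)).trans
      ((condExp_condExp_of_le (𝓕.mono hst) (𝓕.le t)).trans (hZ s).symm)
  · exact Eventually.of_forall fun ω t =>
      ⟨le_max_left _ _, max_le (hle t ω) (min_le_left _ _)⟩

/-- Some event `{x ≤ k}` is non-null, hence has probability one by triviality. This bound on `X_0`
is what makes the terminal value of the price system integrable. -/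
lemma lintegral_ofReal_exp_lt_top_of_trivial [IsProbabilityMeasure P] {m' : MeasurableSpace Ω}
    (htriv : ∀ A : Set Ω, MeasurableSet[m'] A → P A = 0 ∨ P A = 1) (hm : m' ≤ m) {x : Ω → ℝ}
    (hx : Measurable[m'] x) : ∫⁻ ω, ENNReal.ofReal (Real.exp (x ω)) ∂P < ∞ := by
  obtain ⟨k, hk⟩ : ∃ k : ℕ, P (x ⁻¹' Set.Iic (k : ℝ)) ≠ 0 := by
    by_contra! h
    have h1 : (⋃ k : ℕ, x ⁻¹' Set.Iic (k : ℝ)) = Set.univ :=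
      Set.eq_univ_of_forall fun ω => Set.mem_iUnion.2 (exists_nat_ge (x ω))
    have h2 := measure_iUnion_null h
    rw [h1, measure_univ] at h2
    exact one_ne_zero h2
  have h1 := (htriv _ (hx measurableSet_Iic)).resolve_left hk
  have h2 : ∀ᵐ ω ∂P, x ω ≤ k :=
    (prob_compl_eq_zero_iff (hm _ (hx measurableSet_Iic))).2 h1
  calc ∫⁻ ω, ENNReal.ofReal (Real.exp (x ω)) ∂P
      ≤ ∫⁻ _, ENNReal.ofReal (Real.exp k) ∂P := lintegral_mono_ae (by
        filter_upwards [h2] with ω hω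
        exact ENNReal.ofReal_le_ofReal (Real.exp_le_exp.2 hω))
    _ < ∞ := by simp

variable {X : Set.Icc (0 : ℝ) T → Ω → ℝ} [IsProbabilityMeasure P]

theorem ConditionA.admitsCPS_exp (hT : 0 < T)
    (h𝓕₀ : ∀ A : Set Ω, MeasurableSet[𝓕 ⟨0, Set.left_mem_Icc.2 hT.le⟩] A → P A = 0 ∨ P A = 1)
    (hX : ConditionA P 𝓕 X) {ε : ℝ} (hε : 0 < ε) :
    AdmitsCPS P 𝓕 (fun t ω => Real.exp (X t ω)) ε := by
  have hXa := hX.adapted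
  -- The half-width is chosen so that `exp (2δ) = 1 + ε`.
  obtain ⟨D, N, hDm, hNm, hD, hN, hD1, hN1, hcomp⟩ :=
    hX.exists_density_pair hT (δ := Real.log (1 + ε) / 2) (half_pos (Real.log_pos (by linarith)))
  rw [mul_div_cancel₀ _ two_ne_zero, Real.exp_log (by linarith)] at hcomp
  set X₀ := X ⟨0, le_rfl, hT.le⟩ with hX₀
  have hX₀m : Measurable X₀ := hXa.measurable_of_filtration _
  set Q := P.withDensity D with hQ
  have hQprob : IsProbabilityMeasure Q := ⟨by rw [hQ, withDensity_apply _ MeasurableSet.univ]; simpa⟩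
  have hQP : Q ≪ P := withDensity_absolutelyContinuous _ _
  have hPQ : P ≪ Q := withDensity_absolutelyContinuous' hDm.aemeasurable
    (hD.mono fun ω h => h.1.ne')
  let M : Ω → ℝ := fun ω => Real.exp (X₀ ω) * (N ω).toReal / (D ω).toReal
  have hM0 : ∀ ω, 0 ≤ M ω := fun ω => by positivity
  have hMm : Measurable M :=
    ((Real.measurable_exp.comp hX₀m).mul hNm.ennreal_toReal).div hDm.ennreal_toReal
  have hDM : ∀ᵐ ω ∂P, D ω * ENNReal.ofReal (M ω) = N ω * ENNReal.ofReal (Real.exp (X₀ ω)) := by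
    filter_upwards [hD, hN] with ω h1 h2
    have h3 : 0 < (D ω).toReal := ENNReal.toReal_pos h1.1.ne' h1.2.ne
    simp only [M]
    rw [ENNReal.ofReal_div_of_pos h3, ENNReal.ofReal_mul (Real.exp_pos _).le,
      ENNReal.ofReal_toReal h1.2.ne, ENNReal.ofReal_toReal h2.ne,
      ENNReal.mul_div_cancel h1.1.ne' h1.2.ne, mul_comm]
  have hQint : ∀ B, MeasurableSet B → ∀ g : Ω → ℝ≥0∞, Measurable g →
      ∫⁻ ω in B, g ω ∂Q = ∫⁻ ω in B, D ω * g ω ∂P := fun B hB g hg => by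
    rw [hQ, setLIntegral_withDensity_eq_setLIntegral_mul _ hDm hg hB]
    rfl
  have hQM : ∀ B, MeasurableSet B → ∫⁻ ω in B, ENNReal.ofReal (M ω) ∂Q =
      ∫⁻ ω in B, N ω * ENNReal.ofReal (Real.exp (X₀ ω)) ∂P := fun B hB => by
    rw [hQint B hB _ hMm.ennreal_ofReal]
    exact lintegral_congr_ae (ae_restrict_of_ae hDM)
  have hMint : Integrable M Q := by
    refine ⟨hMm.aestronglyMeasurable, ?_⟩
    rw [hasFiniteIntegral_iff_ofReal (Eventually.of_forall hM0), ← setLIntegral_univ,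
      hQM _ MeasurableSet.univ, setLIntegral_univ, hN1]
    exact lintegral_ofReal_exp_lt_top_of_trivial h𝓕₀ (𝓕.le _) (hXa _).measurable
  have hε1 : 0 < 1 + ε := by linarith
  refine AdmitsCPS.of_condExp_bounds hε
    (fun t => Real.continuous_exp.comp_stronglyMeasurable (hXa t))
    (fun t ω => Real.exp_pos _) hQP hPQ (M := M) fun t => ?_
  obtain ⟨C, hC, hcover, hCcomp⟩ := hcomp t
  have hYm : Measurable[𝓕 t] fun ω => ENNReal.ofReal (Real.exp (X t ω)) :=
    (ENNReal.measurable_ofReal.comp Real.measurable_exp).comp (hXa t).measurable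
  have hZm : Measurable[𝓕 t] fun ω => ENNReal.ofReal ((Q[M | 𝓕 t]) ω) :=
    ENNReal.measurable_ofReal.comp stronglyMeasurable_condExp.measurable
  have hYQ : ∀ B, MeasurableSet[𝓕 t] B → ∫⁻ ω in B, ENNReal.ofReal (Real.exp (X t ω)) ∂Q =
      ∫⁻ ω in B, D ω * ENNReal.ofReal (Real.exp (X t ω)) ∂P := fun B hB =>
    hQint B (𝓕.le t _ hB) _ (hYm.mono (𝓕.le t) le_rfl)
  have hZQ : ∀ B, MeasurableSet[𝓕 t] B → ∫⁻ ω in B, ENNReal.ofReal ((Q[M | 𝓕 t]) ω) ∂Q =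
      ∫⁻ ω in B, N ω * ENNReal.ofReal (Real.exp (X₀ ω)) ∂P := fun B hB => by
    rw [setLIntegral_ofReal_condExp (𝓕.le t) hMint hM0 hB, hQM B (𝓕.le t _ hB)]
  have hupper := ae_le_of_setLIntegral_le_on_cover (𝓕.le t) (Q := Q) hZm
    (hYm.const_mul (ENNReal.ofReal (1 + ε))) hC hcover (fun n B hB hBC => by
      rw [lintegral_const_mul' _ _ ENNReal.ofReal_ne_top, hYQ B hB, hZQ B hB]
      exact (hCcomp n B hB hBC).1)
  have hlower := ae_le_of_setLIntegral_le_on_cover (𝓕.le t) (Q := Q) hYm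
    (hZm.const_mul (ENNReal.ofReal (1 + ε))) hC hcover (fun n B hB hBC => by
      rw [lintegral_const_mul' _ _ ENNReal.ofReal_ne_top, hYQ B hB, hZQ B hB]
      exact (hCcomp n B hB hBC).2)
  filter_upwards [hupper, hlower, condExp_nonneg (m := 𝓕 t) (μ := Q) (Eventually.of_forall hM0)]
    with ω h1 h2 h3
  rw [← ENNReal.ofReal_mul hε1.le] at h1 h2
  refine ⟨?_, (ENNReal.ofReal_le_ofReal_iff (by positivity)).1 h1⟩
  rw [inv_mul_le_iff₀ hε1]
  exact (ENNReal.ofReal_le_ofReal_iff (mul_nonneg hε1.le h3)).1 h2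

end PriceSystem

/-! ### The theorem -/

theorem corollary1 {Ω : Type*} {m : MeasurableSpace Ω} (P : Measure Ω) [IsProbabilityMeasure P]
    {T : ℝ} (hT : 0 < T) (𝓕 : Filtration (Set.Icc (0 : ℝ) T) m)
    (h𝓕₀ : ∀ A : Set Ω, MeasurableSet[𝓕 ⟨0, Set.left_mem_Icc.2 hT.le⟩] A → P A = 0 ∨ P A = 1)
    (X : Set.Icc (0 : ℝ) T → Ω → ℝ) (hX : ConditionA P 𝓕 X)
    (f : ℝ → ℝ) (hf : Continuous f)
    (hmono : (Monotone f ∧ Tendsto f atBot atBot ∧ Tendsto f atTop atTop) ∨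
      (Antitone f ∧ Tendsto f atBot atTop ∧ Tendsto f atTop atBot)) :
    ConditionA P 𝓕 (fun t ω => f (X t ω)) ∧
    ∀ ε : ℝ, 0 < ε →
      AdmitsCPS P 𝓕 (fun t ω => Real.exp (f (X t ω))) ε ∧
      AdmitsCPS P
        (Filtration.natural (fun t ω => f (X t ω))
          (fun t => hf.comp_stronglyMeasurable ((hX.adapted t).mono (𝓕.le t))))
        (fun t ω => Real.exp (f (X t ω))) ε := by
  have hA : ConditionA P 𝓕 (fun t ω => f (X t ω)) := by
    rcases hmono with ⟨h, hbot, htop⟩ | ⟨h, hbot, htop⟩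
    · exact hX.comp_monotone hT.le hf h hbot htop
    · simpa only [neg_neg] using (hX.comp_monotone hT.le (f := fun x => -f x) hf.neg h.neg
        (tendsto_neg_atTop_atBot.comp hbot) (tendsto_neg_atBot_atTop.comp htop)).neg hT.le
  -- The natural filtration is contained in `𝓕`, so it inherits both condition (A) and triviality at
  -- time `0`.
  have hle : Filtration.natural (fun t ω => f (X t ω))
      (fun t => hf.comp_stronglyMeasurable ((hX.adapted t).mono (𝓕.le t))) ≤ 𝓕 := fun t =>
    iSup₂_le fun s hst => ((hA.adapted s).mono (𝓕.mono hst)).measurable.comap_le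
  refine ⟨hA, fun ε hε => ⟨hA.admitsCPS_exp hT h𝓕₀ hε, ?_⟩⟩
  exact (hA.mono_filtration hT.le hle (Filtration.stronglyAdapted_natural _)).admitsCPS_exp hT
    (fun A hAm => h𝓕₀ A (hle _ _ hAm)) hε
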